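/- Let $V^1$ be the two-sorted theory of bounded arithmetic (numbers $x,y,\dots$ and finite sets $X,Y,\dots$ of numbers, language $0,1,+,\cdot,|X|,=,\le,\in$) axiomatized by 2-BASIC, comprehension for $\Sigma^{1,b}_0$-formulas and induction for $\Sigma^{1,b}_1$-formulas. Here $\langle x,y\rangle=\frac{(x+y)(x+y+1)}{2}+y$, $R(x,y)$ stands for $\langle x,y\rangle\in R$, $X\le t$ stands for $|X|\le t$, and functions are coded by their graphs. In $V^1$, an *instance* $\Theta=(\mathcal X,\ddot{\mathcal A})$ with parameters $n,l$ consists of an input digraph $\mathcal X=(V_{\mathcal X},E_{\mathcal X})$ with $V_{\mathcal X}=\{0,\dots,n-1\}$ and $E_{\mathcal X}\subseteq V_{\mathcal X}^2$, and a target digraph with domains $\ddot{\mathcal A}=(V_{\ddot{\mathcal A}},E_{\ddot{\mathcal A}})$, where $V_{\ddot{\mathcal A}}\subseteq\{\langle i,a\rangle: i<n,\ a<l\}$ codes the domains $D_i=\{a<l:\langle i,a\rangle\in V_{\ddot{\mathcal A}}\}$ and $E_{\ddot{\mathcal A}}$ is a binary relation on $V_{\ddot{\mathcal A}}$; write $E^{ij}_{\ddot{\mathcal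 A}}(a,b)$ for $E_{\ddot{\mathcal A}}(\langle i,a\rangle,\langle j,b\rangle)$. An *undirected path of length $t$* is a digraph on $\{0,\dots,t\}$ with an edge, in at least one direction, between $i$ and $i+1$ for each $i<t$, and no other edges. An *undirected cycle of length $t\ge1$* is a digraph on $\{0,\dots,t-1\}$ with an edge, in at least one direction, between $i$ and $i+1$ for each $i<t-1$ and between $t-1$ and $0$, and no other edges. A *lift* of a homomorphism $H$ from a path or cycle to $\mathcal X$ is a homomorphism $H'$ from it to the digraph $(V_{\ddot{\mathcal A}},E_{\ddot{\mathcal A}})$ such that $H(p)=k$ implies $H'(p)=\langle k,c\rangle$ for some $c\in D_k$. * $\Theta$ is *cycle-consistent* if it is $1$-consistent (for all $i,j<n$ and $a\in D_i$: if $E_{\mathcal X}(i,j)$, then $E^{ij}_{\ddot{\mathcal A}}(a,b)$ for some $b\in D_j$; if $E_{\mathcal X}(j,i)$, then $E^{ji}_{\ddot{\mathcal A}}(b,a)$ for some $b\in D_j$), and for all $k<n$, $a\in D_k$ and $t<n$, every homomorphism $H$ from an undirected cycle of length $t$ to $\mathcal X$ with $H(0)=k$ has a lift $H'$ with $H'(0)=\langle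 k,a\rangle$. * $\mathrm{Linked}(a,b,i,j,\Theta)$ holds if there are $t<nl$, an undirected path of length $t$, a homomorphism $H$ from it to $\mathcal X$ with $H(0)=i$, $H(t)=j$, and a lift $H'$ of $H$ with $H'(0)=\langle i,a\rangle$, $H'(t)=\langle j,b\rangle$. $\Theta$ is *linked* if $\mathrm{Linked}(a,b,i,i,\Theta)$ for all $i<n$ and all $a,b\in D_i$. * $\Theta$ is *fragmented* if $V_{\mathcal X}$ is the union of two disjoint non-empty sets with no edge of $\mathcal X$ between them. **Lemma.** $V^1$ proves: for all $n,l$ and every instance $\Theta$, if $\Theta$ is cycle-consistent, not fragmented and not linked, then for every $i<n$ there exist $a,b\in D_i$ such that $\neg\mathrm{Linked}(a,b,i,i,\Theta)$; that is, the relation $\mathrm{Linked}(\cdot,\cdot,i,i,\Theta)$ is a proper subrelation of $D_i\times D_i$. -/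

import Mathlib

namespace BA

/-! ## Two-sorted formulas over the language `0, 1, +, ·, |X|, =₁, =₂, ≤, ∈`

Variables of both sorts are named by natural numbers. -/

/-- Number terms. `len X` is the length `|X|` of the set variable `X`. -/
inductive Term where
  | var (x : ℕ)
  | zero
  | one
  | add (s t : Term)
  | mul (s t : Term)
  | len (X : ℕ)

instance : Zero Term := ⟨Term.zero⟩
instance : One Term := ⟨Term.one⟩
instance : Add Term := ⟨Term.add⟩
instance : Mul Term := ⟨Term.mul⟩

/-- Two-sorted formulas. -/
inductive Formula where
  | eqN (s t : Term)
  | eqS (X Y : ℕ)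
  | le (s t : Term)
  | mem (t : Term) (X : ℕ)
  | not (φ : Formula)
  | and (φ ψ : Formula)
  | or (φ ψ : Formula)
  | exN (x : ℕ) (φ : Formula)
  | allN (x : ℕ) (φ : Formula)
  | exS (X : ℕ) (φ : Formula)
  | allS (X : ℕ) (φ : Formula)

/-- The number variables of a term. -/
def Term.nums : Term → Finset ℕ
  | .var x => {x}
  | .zero => ∅
  | .one => ∅
  | .add s t => s.nums ∪ t.nums
  | .mul s t => s.nums ∪ t.nums
  | .len _ => ∅

/-- The set variables of a term. -/
def Term.sets : Term → Finset ℕ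
  | .var _ => ∅
  | .zero => ∅
  | .one => ∅
  | .add s t => s.sets ∪ t.sets
  | .mul s t => s.sets ∪ t.sets
  | .len X => {X}

/-- The free number variables of a formula. -/
def Formula.freeN : Formula → Finset ℕ
  | .eqN s t => s.nums ∪ t.nums
  | .eqS _ _ => ∅
  | .le s t => s.nums ∪ t.nums
  | .mem t _ => t.nums
  | .not φ => φ.freeN
  | .and φ ψ => φ.freeN ∪ ψ.freeN
  | .or φ ψ => φ.freeN ∪ ψ.freeN
  | .exN x φ => φ.freeN.erase x
  | .allN x φ => φ.freeN.erase x
  | .exS _ φ => φ.freeN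
  | .allS _ φ => φ.freeN

/-- The free set variables of a formula. -/
def Formula.freeS : Formula → Finset ℕ
  | .eqN s t => s.sets ∪ t.sets
  | .eqS X Y => {X, Y}
  | .le s t => s.sets ∪ t.sets
  | .mem t X => insert X t.sets
  | .not φ => φ.freeS
  | .and φ ψ => φ.freeS ∪ ψ.freeS
  | .or φ ψ => φ.freeS ∪ ψ.freeS
  | .exN _ φ => φ.freeS
  | .allN _ φ => φ.freeS
  | .exS X φ => φ.freeS.erase X
  | .allS X φ => φ.freeS.erase X

namespace Formula

def imp (φ ψ : Formula) : Formula := or (not φ) ψ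
def iff (φ ψ : Formula) : Formula := and (imp φ ψ) (imp ψ φ)

/-- `∃ x ≤ t, φ` -/
def exLe (x : ℕ) (t : Term) (φ : Formula) : Formula := exN x (and (le (.var x) t) φ)
/-- `∀ x ≤ t, φ` -/
def allLe (x : ℕ) (t : Term) (φ : Formula) : Formula := allN x (imp (le (.var x) t) φ)
/-- `∃ X ≤ t, φ`, that is `∃ X (|X| ≤ t ∧ φ)` -/
def exSLe (X : ℕ) (t : Term) (φ : Formula) : Formula := exS X (and (le (.len X) t) φ)
/-- `∀ X ≤ t, φ`, that is `∀ X (|X| ≤ t → φ)` -/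
def allSLe (X : ℕ) (t : Term) (φ : Formula) : Formula := allS X (imp (le (.len X) t) φ)

end Formula

/-- `Σ₀^{1,b}`: all number quantifiers are bounded, and there are no set quantifiers. -/
inductive IsSigma0 : Formula → Prop
  | eqN (s t : Term) : IsSigma0 (.eqN s t)
  | eqS (X Y : ℕ) : IsSigma0 (.eqS X Y)
  | le (s t : Term) : IsSigma0 (.le s t)
  | mem (t : Term) (X : ℕ) : IsSigma0 (.mem t X)
  | not {φ : Formula} : IsSigma0 φ → IsSigma0 (.not φ)
  | and {φ ψ : Formula} : IsSigma0 φ → IsSigma0 ψ → IsSigma0 (.and φ ψ)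
  | or {φ ψ : Formula} : IsSigma0 φ → IsSigma0 ψ → IsSigma0 (.or φ ψ)
  | exLe {x : ℕ} {t : Term} {φ : Formula} :
      x ∉ t.nums → IsSigma0 φ → IsSigma0 (.exLe x t φ)
  | allLe {x : ℕ} {t : Term} {φ : Formula} :
      x ∉ t.nums → IsSigma0 φ → IsSigma0 (.allLe x t φ)

/-- The classes `Σ₁^{1,b}` (polarity `true`) and `Π₁^{1,b}` (polarity `false`), defined
simultaneously as the smallest classes with these closure properties. -/
inductive IsSigmaPi1 : Bool → Formula → Prop
  | base {φ : Formula} (p : Bool) : IsSigma0 φ → IsSigmaPi1 p φ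
  | and {p : Bool} {φ ψ : Formula} :
      IsSigmaPi1 p φ → IsSigmaPi1 p ψ → IsSigmaPi1 p (.and φ ψ)
  | or {p : Bool} {φ ψ : Formula} :
      IsSigmaPi1 p φ → IsSigmaPi1 p ψ → IsSigmaPi1 p (.or φ ψ)
  | not {p : Bool} {φ : Formula} : IsSigmaPi1 p φ → IsSigmaPi1 (!p) (.not φ)
  | exSLe {X : ℕ} {t : Term} {φ : Formula} :
      X ∉ t.sets → IsSigmaPi1 true φ → IsSigmaPi1 true (.exSLe X t φ)
  | allSLe {X : ℕ} {t : Term} {φ : Formula} :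
      X ∉ t.sets → IsSigmaPi1 false φ → IsSigmaPi1 false (.allSLe X t φ)

def IsSigma1 (φ : Formula) : Prop := IsSigmaPi1 true φ

/-! ## Structures, satisfaction, provability -/

/-- A two-sorted structure; both equalities are interpreted as true equality. The second sort
is an arbitrary non-empty domain. -/
structure Struct where
  Num : Type
  Str : Type
  zero : Num
  one : Num
  add : Num → Num → Num
  mul : Num → Num → Num
  len : Str → Num
  le : Num → Num → Prop
  mem : Num → Str → Prop
  nonemptyStr : Nonempty Str

def Term.eval (M : Struct) (v : ℕ → M.Num) (V : ℕ → M.Str) : Term → M.Num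
  | .var x => v x
  | .zero => M.zero
  | .one => M.one
  | .add s t => M.add (s.eval M v V) (t.eval M v V)
  | .mul s t => M.mul (s.eval M v V) (t.eval M v V)
  | .len X => M.len (V X)

/-- `φ.Sat M v V`: the formula `φ` holds in `M` under the assignments `v` (numbers) and
`V` (sets). -/
def Formula.Sat (M : Struct) : Formula → (ℕ → M.Num) → (ℕ → M.Str) → Prop
  | .eqN s t, v, V => s.eval M v V = t.eval M v V
  | .eqS X Y, _, V => V X = V Y
  | .le s t, v, V => M.le (s.eval M v V) (t.eval M v V)
  | .mem t X, v, V => M.mem (t.eval M v V) (V X)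
  | .not φ, v, V => ¬ φ.Sat M v V
  | .and φ ψ, v, V => φ.Sat M v V ∧ ψ.Sat M v V
  | .or φ ψ, v, V => φ.Sat M v V ∨ ψ.Sat M v V
  | .exN x φ, v, V => ∃ a, φ.Sat M (Function.update v x a) V
  | .allN x φ, v, V => ∀ a, φ.Sat M (Function.update v x a) V
  | .exS X φ, v, V => ∃ A, φ.Sat M v (Function.update V X A)
  | .allS X φ, v, V => ∀ A, φ.Sat M v (Function.update V X A)

/-- The universal closure of `φ` holds in `M`. -/
def Struct.Models (M : Struct) (φ : Formula) : Prop :=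
  ∀ (v : ℕ → M.Num) (V : ℕ → M.Str), φ.Sat M v V

/-- `φ` is a theorem of the theory axiomatized by (the universal closures of) the formulas in
`T`: it is a first-order (two-sorted) logical consequence of `T`. Both sorts of a structure are
arbitrary domains, in particular the second sort is not required to consist of all finite sets of
numbers. Since the language is countable, small structures suffice. -/
def Proves (T : Set Formula) (φ : Formula) : Prop :=
  ∀ M : Struct, (∀ ψ ∈ T, M.Models ψ) → M.Models φ

/-! ## Writing formulas with automatically chosen bound variables

A `Builder` is a formula that still depends on the least index from which all variable names are
unused. A quantifier takes the next name, so a bound variable never captures a variable bound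
further outside. -/

abbrev Builder := ℕ → Formula

/-- The sentence written by a builder without parameters. -/
def sentence (φ : Builder) : Formula := φ 0

def eqN (s t : Term) : Builder := fun _ => .eqN s t
def eqS (X Y : ℕ) : Builder := fun _ => .eqS X Y
def le (s t : Term) : Builder := fun _ => .le s t
def mem (t : Term) (X : ℕ) : Builder := fun _ => .mem t X
def neg (φ : Builder) : Builder := fun d => .not (φ d)
def conj (φ ψ : Builder) : Builder := fun d => .and (φ d) (ψ d)
def disj (φ ψ : Builder) : Builder := fun d => .or (φ d) (ψ d)
def impl (φ ψ : Builder) : Builder := fun d => .imp (φ d) (ψ d)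
def equi (φ ψ : Builder) : Builder := fun d => .iff (φ d) (ψ d)

infix:50 " ≐ " => eqN
infix:50 " ≼ " => le
prefix:max "∼" => neg
infixr:35 " ⩓ " => conj
infixr:30 " ⩔ " => disj
infixr:25 " ⟹ " => impl
infix:20 " ⟺ " => equi

def exN (f : Term → Builder) : Builder := fun d => .exN d (f (.var d) (d + 1))
def allN (f : Term → Builder) : Builder := fun d => .allN d (f (.var d) (d + 1))
def exS (f : ℕ → Builder) : Builder := fun d => .exS d (f d (d + 1))
def allS (f : ℕ → Builder) : Builder := fun d => .allS d (f d (d + 1))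

/-- `s < t`, that is `s ≤ t ∧ s ≠ t` -/
def lt (s t : Term) : Builder := s ≼ t ⩓ ∼(s ≐ t)

infix:50 " ≺ " => lt

/-- `∃ x ≤ t, f x` -/
def exLe (t : Term) (f : Term → Builder) : Builder := exN fun x => x ≼ t ⩓ f x
/-- `∀ x ≤ t, f x` -/
def allLe (t : Term) (f : Term → Builder) : Builder := allN fun x => x ≼ t ⟹ f x
/-- `∃ x < t, f x` -/
def exLt (t : Term) (f : Term → Builder) : Builder := exLe t fun x => ∼(x ≐ t) ⩓ f x
/-- `∀ x < t, f x` -/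
def allLt (t : Term) (f : Term → Builder) : Builder := allLe t fun x => ∼(x ≐ t) ⟹ f x
/-- `∃ X ≤ t, f X` -/
def exSLe (t : Term) (f : ℕ → Builder) : Builder := exS fun X => .len X ≼ t ⩓ f X
/-- `∀ X ≤ t, f X` -/
def allSLe (t : Term) (f : ℕ → Builder) : Builder := allS fun X => .len X ≼ t ⟹ f X
/-- `∃ X < t, f X` -/
def exSLt (t : Term) (f : ℕ → Builder) : Builder := exSLe t fun X => ∼(.len X ≐ t) ⩓ f X
/-- `∀ X < t, f X` -/
def allSLt (t : Term) (f : ℕ → Builder) : Builder := allSLe t fun X => ∼(.len X ≐ t) ⟹ f X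

/-! ## The theory `V¹` -/

/-- The axioms 2-BASIC. -/
inductive Basic2 : Formula → Prop
  | B1 : Basic2 (sentence <| allN fun x => ∼(x + 1 ≐ 0))
  | B2 : Basic2 (sentence <| allN fun x => allN fun y => x + 1 ≐ y + 1 ⟹ x ≐ y)
  | B3 : Basic2 (sentence <| allN fun x => x + 0 ≐ x)
  | B4 : Basic2 (sentence <| allN fun x => allN fun y => x + (y + 1) ≐ (x + y) + 1)
  | B5 : Basic2 (sentence <| allN fun x => x * 0 ≐ 0)
  | B6 : Basic2 (sentence <| allN fun x => allN fun y => x * (y + 1) ≐ (x * y) + x)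
  | B7 : Basic2 (sentence <| allN fun x => allN fun y => x ≼ y ⩓ y ≼ x ⟹ x ≐ y)
  | B8 : Basic2 (sentence <| allN fun x => allN fun y => x ≼ x + y)
  | B9 : Basic2 (sentence <| allN fun x => 0 ≼ x)
  | B10 : Basic2 (sentence <| allN fun x => allN fun y => x ≼ y ⩔ y ≼ x)
  | B11 : Basic2 (sentence <| allN fun x => allN fun y => x ≼ y ⟺ x ≺ y + 1)
  | B12 : Basic2 (sentence <| allN fun x => ∼(x ≐ 0) ⟹ exLe x fun y => y + 1 ≐ x)
  | L1 : Basic2 (sentence <| allS fun X => allN fun y => mem y X ⟹ y ≺ .len X)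
  | L2 : Basic2 (sentence <| allS fun X => allN fun y => y + 1 ≐ .len X ⟹ mem y X)
  | SE : Basic2 (sentence <| allS fun X => allS fun Y =>
      (.len X ≐ .len Y ⩓ allLt (.len X) fun i => mem i X ⟺ mem i Y) ⟺ eqS X Y)

/-- The comprehension axiom `∀ z ∃ X ≤ z ∀ y < z (y ∈ X ↔ φ(y))`. -/
def compAxiom (φ : Formula) (y z X : ℕ) : Formula :=
  .allN z (.exSLe X (.var z) (.allN y (.imp
    (.and (.le (.var y) (.var z)) (.not (.eqN (.var y) (.var z))))
    (.iff (.mem (.var y) X) φ))))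

/-- The induction axiom `φ(0) ∧ ∀ y (φ(y) → φ(y+1)) → ∀ x φ(x)` for `φ = φ(x)`. Here `φ(t)`, for
a term `t` without `x`, is written as `∀ x (x = t → φ)`. -/
def indAxiom (φ : Formula) (x y : ℕ) : Formula :=
  .imp
    (.and (.allN x (.imp (.eqN (.var x) 0) φ))
      (.allN y (.imp (.allN x (.imp (.eqN (.var x) (.var y)) φ))
        (.allN x (.imp (.eqN (.var x) (.var y + 1)) φ)))))
    (.allN x φ)

/-- The axioms of `V¹`: 2-BASIC, comprehension for `Σ₀^{1,b}`-formulas and induction for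
`Σ₁^{1,b}`-formulas (which include the `Σ₀^{1,b}`-formulas). -/
inductive V1 : Set Formula
  | basic {φ : Formula} : Basic2 φ → V1 φ
  | comp {φ : Formula} (y z X : ℕ) : IsSigma0 φ → y ≠ z → X ∉ φ.freeS → V1 (compAxiom φ y z X)
  | ind {φ : Formula} (x y : ℕ) : IsSigma1 φ → y ≠ x → y ∉ φ.freeN → V1 (indAxiom φ x y)

/-! ## Pairing and coded relations -/

/-- `z = ⟨x, y⟩ = (x + y)(x + y + 1)/2 + y` -/
def isPair (z x y : Term) : Builder := z + z ≐ (x + y) * (x + y + 1) + (y + y)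

/-- `f ⟨x, y⟩`: the pairing function as an argument. The value `⟨x, y⟩` is introduced by a bounded
quantifier. -/
def withPair (x y : Term) (f : Term → Builder) : Builder :=
  exLe ((x + y) * (x + y + 1) + y) fun z => isPair z x y ⩓ f z

/-- `R(x, y)`, that is `⟨x, y⟩ ∈ R` -/
def rel (R : ℕ) (x y : Term) : Builder := withPair x y fun z => mem z R

/-- `H(p) = ⟨k, c⟩` for a function coded by `H` -/
def mapsToPair (H : ℕ) (p k c : Term) : Builder := withPair k c fun s => rel H p s

/-! ## Digraphs, homomorphisms, paths, cycles

The vertex set of the digraphs that are mapped (paths and cycles) is an initial segment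
`{0, …, s-1}`, given by the number `s`. -/

/-- `H` codes a map from `{0, …, s-1}` to the set `B`, whose elements are less than `m`. -/
def isMap (s : Term) (B : ℕ) (m : Term) (H : ℕ) : Builder :=
  (allLt s fun i => exLt m fun j => mem j B ⩓ rel H i j) ⩓
  (allLt s fun i => allLt m fun j₁ => allLt m fun j₂ =>
    (mem j₁ B ⩓ mem j₂ B) ⩓ (rel H i j₁ ⩓ rel H i j₂) ⟹ j₁ ≐ j₂)

/-- `H` codes a homomorphism from the digraph `({0, …, s-1}, EG)` to the digraph `(B, EB)`, where
the elements of `B` are less than `m`. -/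
def isHom (s : Term) (EG : ℕ) (B EB : ℕ) (m : Term) (H : ℕ) : Builder :=
  isMap s B m H ⩓
  (allLt s fun i₁ => allLt s fun i₂ => allLt m fun j₁ => allLt m fun j₂ =>
    rel EG i₁ i₂ ⩓ rel H i₁ j₁ ⩓ rel H i₂ j₂ ⟹ rel EB j₁ j₂)

/-- `({0, …, t-1}, E)` is an undirected cycle of length `t ≥ 1`: there is an edge (in at least one
direction) between `i` and `i + 1` for `i + 1 < t` and between `t - 1` and `0`, and no other
edge. -/
def isCycle (t : Term) (E : ℕ) : Builder :=
  ∼(t ≐ 0) ⩓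
  (allLt t fun i => allLt t fun j =>
    (j ≐ i + 1 ⩔ (i + 1 ≐ t ⩓ j ≐ 0) ⟹ rel E i j ⩔ rel E j i) ⩓
    (∼(j ≐ i + 1) ⩓ ∼(i ≐ j + 1) ⩓ ∼(i + 1 ≐ t ⩓ j ≐ 0) ⩓ ∼(j + 1 ≐ t ⩓ i ≐ 0) ⟹
      ∼(rel E i j) ⩓ ∼(rel E j i)))

/-- `({0, …, t}, E)` is an undirected path of length `t`: there is an edge (in at least one
direction) between `i` and `i + 1` for `i < t`, and no other edge. -/
def isPath (t : Term) (E : ℕ) : Builder :=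
  (allLt t fun i => rel E i (i + 1) ⩔ rel E (i + 1) i) ⩓
  (allLe t fun i => allLe t fun j =>
    ∼(j ≐ i + 1) ⩓ ∼(i ≐ j + 1) ⟹ ∼(rel E i j) ⩓ ∼(rel E j i))

/-! ## Instances -/

/-- The parameters of an instance `Θ = (𝒳, 𝒜)`: the numbers `n` (of variables) and `l` (size of
the universe), the input digraph `(VX, EX)`, and the target digraph with domains `(VA, EA)`. -/
structure Inst where
  n : Term
  l : Term
  VX : ℕ
  EX : ℕ
  VA : ℕ
  EA : ℕ

/-- `a ∈ D_i`. The domains are coded by the set `VA` of all `⟨i, a⟩` with `a ∈ D_i`. -/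
def Inst.dom (Θ : Inst) (i a : Term) : Builder := rel Θ.VA i a

/-- The edge `E^{ij}(a, b)`, that is `EA(⟨i, a⟩, ⟨j, b⟩)`. -/
def Inst.edge (Θ : Inst) (i j a b : Term) : Builder :=
  withPair i a fun u => withPair j b fun v => rel Θ.EA u v

/-- `∃ a ∈ D_i, f a`; the elements of a domain are less than `l`. -/
def Inst.exDom (Θ : Inst) (i : Term) (f : Term → Builder) : Builder :=
  exLt Θ.l fun a => Θ.dom i a ⩓ f a

/-- `∀ a ∈ D_i, f a` -/
def Inst.allDom (Θ : Inst) (i : Term) (f : Term → Builder) : Builder :=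
  allLt Θ.l fun a => Θ.dom i a ⟹ f a

/-- `Θ` is an instance: `VX = {0, …, n-1}`, `EX` is a binary relation on `VX`, `VA` consists of
pairs `⟨i, a⟩` with `i < n` and `a < l`, and `EA` is a binary relation on `VA`. -/
def Inst.DG (Θ : Inst) : Builder :=
  (.len Θ.VX ≐ Θ.n ⩓ allLt Θ.n fun i => mem i Θ.VX) ⩓
  (allLt (.len Θ.EX) fun i => allLt (.len Θ.EX) fun j =>
    rel Θ.EX i j ⟹ mem i Θ.VX ⩓ mem j Θ.VX) ⩓
  (allLt (.len Θ.VA) fun u => mem u Θ.VA ⟹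
    exLt Θ.n fun i => exLt Θ.l fun a => isPair u i a) ⩓
  (allLt (.len Θ.EA) fun u => allLt (.len Θ.EA) fun v => rel Θ.EA u v ⟹
    exLt Θ.n fun i => exLt Θ.n fun j => exLt Θ.l fun a => exLt Θ.l fun b =>
      isPair u i a ⩓ isPair v j b ⩓ Θ.dom i a ⩓ Θ.dom j b)

/-- `1`-consistency. -/
def Inst.oneConsistent (Θ : Inst) : Builder :=
  allLt Θ.n fun i => Θ.allDom i fun a => allLt Θ.n fun j =>
    (rel Θ.EX i j ⟹ Θ.exDom j fun b => Θ.edge i j a b) ⩓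
    (rel Θ.EX j i ⟹ Θ.exDom j fun b => Θ.edge j i b a)

/-- `4t²` -/
def fourSq (t : Term) : Term := (1 + 1 + 1 + 1) * (t * t)

/-- `H'` lifts `H` on `{0, …, s-1}`: `H(p) = k` implies `H'(p) = ⟨k, c⟩` for some `c ∈ D_k`. -/
def Inst.lifts (Θ : Inst) (s : Term) (H H' : ℕ) : Builder :=
  allLt Θ.n fun k => allLt s fun p => rel H p k ⟹ Θ.exDom k fun c => mapsToPair H' p k c

/-- Cycle-consistency: `Θ` is `1`-consistent, and for all `k < n`, `a ∈ D_k` and `t < n`, every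
homomorphism `H` from an undirected cycle of length `t` to the input digraph with `H(0) = k` lifts
to a homomorphism `H'` to the target digraph with `H'(0) = ⟨k, a⟩`. -/
def Inst.cycleConsistent (Θ : Inst) : Builder :=
  Θ.oneConsistent ⩓
  allLt Θ.n fun k => Θ.allDom k fun a => allLt Θ.n fun t => allSLe (fourSq t) fun E =>
    withPair t Θ.n fun w => allSLt w fun H =>
      isCycle t E ⩓ isHom t E Θ.VX Θ.EX Θ.n H ⩓ rel H 0 k ⟹
        withPair Θ.n Θ.l fun z => withPair t z fun w' => exSLt w' fun H' =>
          isHom t E Θ.VA Θ.EA z H' ⩓ Θ.lifts t H H' ⩓ mapsToPair H' 0 k a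

/-- `Linked(a, b, i, j, Θ)`: there are an undirected path of some length `t < nl`, a homomorphism
`H` from it to the input digraph with `H(0) = i` and `H(t) = j`, and a lift `H'` of `H` to a
homomorphism to the target digraph with `H'(0) = ⟨i, a⟩` and `H'(t) = ⟨j, b⟩`. -/
def Inst.linked (Θ : Inst) (a b i j : Term) : Builder :=
  exLt (Θ.n * Θ.l) fun t => exSLe (fourSq t) fun E =>
    withPair t Θ.n fun w => exSLe w fun H =>
      isPath t E ⩓ isHom (t + 1) E Θ.VX Θ.EX Θ.n H ⩓ (rel H 0 i ⩓ rel H t j) ⩓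
        withPair Θ.n Θ.l fun z => withPair t z fun w' => exSLe w' fun H' =>
          isHom (t + 1) E Θ.VA Θ.EA z H' ⩓ Θ.lifts (t + 1) H H' ⩓
            mapsToPair H' 0 i a ⩓ mapsToPair H' t j b

/-- `Θ` is linked. -/
def Inst.isLinked (Θ : Inst) : Builder :=
  allLt Θ.n fun i => Θ.allDom i fun a => Θ.allDom i fun b => Θ.linked a b i i

/-- `B` is a non-empty proper subset of `A`. -/
def properSubset (B A : ℕ) : Builder :=
  (allLt (.len B) fun i => mem i B ⟹ mem i A) ⩓
  (exLt (.len B) fun j => mem j B) ⩓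
  (exLt (.len A) fun i => mem i A ⩓ ∼(mem i B))

/-- `Θ` is fragmented: the vertices of the input digraph split into two non-empty complementary
sets without an edge between them. -/
def Inst.isFragmented (Θ : Inst) : Builder :=
  exSLe Θ.n fun V₁ => exSLe Θ.n fun V₂ =>
    properSubset V₁ Θ.VX ⩓ properSubset V₂ Θ.VX ⩓
    (allLt Θ.n fun i => mem i V₁ ⟺ ∼(mem i V₂)) ⩓
    (allLt Θ.n fun i => allLt Θ.n fun j => mem i V₁ ⩓ mem j V₂ ⟹
      ∼(rel Θ.EX i j) ⩓ ∼(rel Θ.EX j i))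

end BA

namespace BA

open Function

/-! ## Definable predicates in a structure -/

section Definability

variable {M : Struct}

/-! Provability is semantic consequence, so the argument takes place inside an arbitrary model `M`
of `V1`. Let the pairs `⟨i, a⟩` with `a ∈ D_i` be the vertices of a graph, joined when an edge of
the target digraph lies above an edge of the input digraph (`StepRel`). Then `Linked` is
connectedness in this graph.

If `c, d ∈ D_j` are not linked, let `C` be the component of `d`; it does not contain `c`. By
1-consistency, a step along an input edge, in either direction, can be lifted from any given vertex.
Hence the set of `i` such that `D_i` meets `C` is closed under input edges, and so is the set of `i`
such that `D_i` is not contained in `C`. Both contain `j`, so both are everything, since otherwise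
they would fragment the input. Thus every `D_i` has an `a` in `C` and a `b` outside it, and no
linking path leaves `C`. This is `exists_not_linkedSem`.

The work lies in obtaining `C` as a set of the model whose elements reach `d` by paths shorter than
`n * l` (`exists_component`). A maximum principle from `Σ₁`-induction (`exists_max`) gives a longest
search tree, stored as the beginning of an enumeration of all vertices; maximality makes its vertex
set closed. Descending from an entry to earlier and earlier entries gives a path whose length is
bounded by the position of that entry. `linkedSem_of_path` and `LinkedSem.mem_of_mem` translate
between such paths and the formula `Linked`.

To use comprehension and induction without writing formulas, `Σ₀`-definability with parameters is a
type class, and instance search builds the formulas. -/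

instance : Zero M.Num := ⟨M.zero⟩
instance : One M.Num := ⟨M.one⟩
instance : Add M.Num := ⟨M.add⟩
instance : Mul M.Num := ⟨M.mul⟩
instance : LE M.Num := ⟨M.le⟩

section Eval

variable (v : ℕ → M.Num) (V : ℕ → M.Str)

@[simp] theorem eval_var (x : ℕ) : (Term.var x).eval M v V = v x := rfl
@[simp] theorem eval_zero : (0 : Term).eval M v V = 0 := rfl
@[simp] theorem eval_one : (1 : Term).eval M v V = 1 := rfl
@[simp] theorem eval_add (s t : Term) :
    (s + t).eval M v V = s.eval M v V + t.eval M v V := rfl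
@[simp] theorem eval_mul (s t : Term) :
    (s * t).eval M v V = s.eval M v V * t.eval M v V := rfl
@[simp] theorem eval_len (X : ℕ) : (Term.len X).eval M v V = M.len (V X) := rfl

@[simp] theorem sat_eqN (s t : Term) :
    (Formula.eqN s t).Sat M v V ↔ s.eval M v V = t.eval M v V := Iff.rfl
@[simp] theorem sat_le (s t : Term) :
    (Formula.le s t).Sat M v V ↔ s.eval M v V ≤ t.eval M v V := Iff.rfl
@[simp] theorem sat_mem (t : Term) (X : ℕ) :
    (Formula.mem t X).Sat M v V ↔ M.mem (t.eval M v V) (V X) := Iff.rfl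
@[simp] theorem sat_not (φ : Formula) : (Formula.not φ).Sat M v V ↔ ¬ φ.Sat M v V := Iff.rfl
@[simp] theorem sat_and (φ ψ : Formula) :
    (Formula.and φ ψ).Sat M v V ↔ φ.Sat M v V ∧ ψ.Sat M v V := Iff.rfl
@[simp] theorem sat_or (φ ψ : Formula) :
    (Formula.or φ ψ).Sat M v V ↔ φ.Sat M v V ∨ ψ.Sat M v V := Iff.rfl
@[simp] theorem sat_exN (x : ℕ) (φ : Formula) :
    (Formula.exN x φ).Sat M v V ↔ ∃ a, φ.Sat M (update v x a) V := Iff.rfl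
@[simp] theorem sat_allN (x : ℕ) (φ : Formula) :
    (Formula.allN x φ).Sat M v V ↔ ∀ a, φ.Sat M (update v x a) V := Iff.rfl
@[simp] theorem sat_exS (X : ℕ) (φ : Formula) :
    (Formula.exS X φ).Sat M v V ↔ ∃ A, φ.Sat M v (update V X A) := Iff.rfl
@[simp] theorem sat_imp (φ ψ : Formula) :
    (Formula.imp φ ψ).Sat M v V ↔ (φ.Sat M v V → ψ.Sat M v V) := by
  simp only [Formula.imp, sat_or, sat_not]; tauto
@[simp] theorem sat_iff (φ ψ : Formula) :
    (Formula.iff φ ψ).Sat M v V ↔ (φ.Sat M v V ↔ ψ.Sat M v V) := by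
  simp only [Formula.iff, sat_and, sat_imp]; tauto

end Eval

/-- Assignments to one set variable and `k` number variables. -/
def Env (M : Struct) : ℕ → Type
  | 0 => Unit × M.Str
  | k + 1 => Env M k × M.Num

/-- The part of an assignment that belongs to the set variable `0` and to the number variables
`0, 2, …, 2 (k - 1)`. The other set variables and the odd number variables hold parameters. -/
def toEnv (v : ℕ → M.Num) (V : ℕ → M.Str) : (k : ℕ) → Env M k
  | 0 => ((), V 0)
  | k + 1 => (toEnv v V k, v (2 * k))

theorem toEnv_update_num {v : ℕ → M.Num} {V : ℕ → M.Str} {x : ℕ} {a : M.Num} :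
    ∀ {k : ℕ}, 2 * k ≤ x → toEnv (update v x a) V k = toEnv v V k
  | 0, _ => rfl
  | k + 1, h => by
    have h₁ : 2 * k ≠ x := by omega
    simp only [toEnv, update_of_ne h₁]
    rw [toEnv_update_num (by omega)]

theorem toEnv_update_set {v : ℕ → M.Num} {V : ℕ → M.Str} {X : ℕ} {A : M.Str} (h : X ≠ 0) :
    ∀ {k : ℕ}, toEnv v (update V X A) k = toEnv v V k
  | 0 => congrArg (Prod.mk ()) (update_of_ne h.symm _ _)
  | k + 1 => by simp only [toEnv]; rw [toEnv_update_set h]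

/-- The assignment `(v, V)` gives the parameters with indices in `[N, N')` the values `(p, P)`. -/
def Agree (N N' : ℕ) (p : ℕ → M.Num) (P : ℕ → M.Str) (v : ℕ → M.Num) (V : ℕ → M.Str) : Prop :=
  ∀ j, N ≤ j → j < N' → v (2 * j + 1) = p j ∧ V (j + 1) = P j

/-- Two definitions are combined by giving their parameters consecutive index blocks. This is why
each definability class starts at an arbitrary `N` and returns the next free index `N'`. -/
theorem Agree.split {N₀ N₁ N₂ : ℕ} {p q : ℕ → M.Num} {P Q : ℕ → M.Str} {v : ℕ → M.Num}
    {V : ℕ → M.Str} (h₁ : N₀ ≤ N₁) (h₂ : N₁ ≤ N₂)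
    (h : Agree N₀ N₂ (fun j => if j < N₁ then p j else q j)
      (fun j => if j < N₁ then P j else Q j) v V) :
    Agree N₀ N₁ p P v V ∧ Agree N₁ N₂ q Q v V := by
  constructor <;> intro j hj hj'
  · simpa [hj'] using h j hj (by omega)
  · simpa [hj, Nat.not_lt.2 hj] using h j (by omega) hj'

/-- Functions given by a term with parameters. -/
class TermDef {k : ℕ} (f : Env M k → M.Num) : Prop where
  out : ∀ N, ∃ N' ≥ N, ∃ (t : Term) (p : ℕ → M.Num) (P : ℕ → M.Str),
    (∀ x ∈ t.nums, x % 2 = 1 ∨ x < 2 * k) ∧ (∀ X ∈ t.sets, X ≤ N') ∧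
    ∀ v V, Agree N N' p P v V → t.eval M v V = f (toEnv v V k)

/-- Set-valued functions given by a set variable or a parameter. -/
class SetDef {k : ℕ} (f : Env M k → M.Str) : Prop where
  out : ∀ N, ∃ N' ≥ N, ∃ (Y : ℕ) (p : ℕ → M.Num) (P : ℕ → M.Str), Y ≤ N' ∧
    ∀ v V, Agree N N' p P v V → V Y = f (toEnv v V k)

/-- Predicates defined by a `Σ₀`-formula with parameters. -/
class Sigma0Def {k : ℕ} (R : Env M k → Prop) : Prop where
  out : ∀ N, ∃ N' ≥ N, ∃ (φ : Formula) (p : ℕ → M.Num) (P : ℕ → M.Str), IsSigma0 φ ∧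
    (∀ x ∈ φ.freeN, x % 2 = 1 ∨ x < 2 * k) ∧ (∀ X ∈ φ.freeS, X ≤ N') ∧
    ∀ v V, Agree N N' p P v V → (φ.Sat M v V ↔ R (toEnv v V k))

variable {k : ℕ}

instance SetDef.const (A : M.Str) : SetDef (fun _ : Env M k => A) := ⟨fun N =>
  ⟨N + 1, by omega, N + 1, fun _ => M.zero, fun _ => A, le_rfl,
    fun v V h => by simp [(h N le_rfl (by omega)).2]⟩⟩

theorem termDef_of_var {f : Env M k → M.Num} (x : ℕ) (hx : x < 2 * k)
    (h : ∀ v V, v x = f (toEnv v V k)) : TermDef f := ⟨fun N =>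
  ⟨N, le_rfl, .var x, fun _ => M.zero, fun _ => M.nonemptyStr.some,
    by simp [Term.nums, hx], by simp [Term.sets], fun v V _ => by simp [h v V]⟩⟩

theorem setDef_of_var {f : Env M k → M.Str} (h : ∀ v V, V 0 = f (toEnv v V k)) : SetDef f := ⟨fun N =>
  ⟨N, le_rfl, 0, fun _ => M.zero, fun _ => M.nonemptyStr.some, by omega, fun v V _ => by simp [h v V]⟩⟩

instance TermDef.var0 : TermDef (fun e : Env M (k + 1) => e.2) :=
  termDef_of_var (2 * k) (by omega) fun _ _ => rfl
instance TermDef.var1 : TermDef (fun e : Env M (k + 2) => e.1.2) :=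
  termDef_of_var (2 * k) (by omega) fun _ _ => rfl
instance TermDef.var2 : TermDef (fun e : Env M (k + 3) => e.1.1.2) :=
  termDef_of_var (2 * k) (by omega) fun _ _ => rfl
instance TermDef.var3 : TermDef (fun e : Env M (k + 4) => e.1.1.1.2) :=
  termDef_of_var (2 * k) (by omega) fun _ _ => rfl
instance TermDef.var4 : TermDef (fun e : Env M (k + 5) => e.1.1.1.1.2) :=
  termDef_of_var (2 * k) (by omega) fun _ _ => rfl
instance TermDef.var5 : TermDef (fun e : Env M (k + 6) => e.1.1.1.1.1.2) :=
  termDef_of_var (2 * k) (by omega) fun _ _ => rfl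
instance TermDef.var6 : TermDef (fun e : Env M (k + 7) => e.1.1.1.1.1.1.2) :=
  termDef_of_var (2 * k) (by omega) fun _ _ => rfl

instance SetDef.var1 : SetDef (fun e : Env M 1 => e.1.2) := setDef_of_var fun _ _ => rfl
instance SetDef.var2 : SetDef (fun e : Env M 2 => e.1.1.2) := setDef_of_var fun _ _ => rfl
instance SetDef.var3 : SetDef (fun e : Env M 3 => e.1.1.1.2) := setDef_of_var fun _ _ => rfl
instance SetDef.var4 : SetDef (fun e : Env M 4 => e.1.1.1.1.2) := setDef_of_var fun _ _ => rfl
instance SetDef.var5 : SetDef (fun e : Env M 5 => e.1.1.1.1.1.2) := setDef_of_var fun _ _ => rfl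
instance SetDef.var6 : SetDef (fun e : Env M 6 => e.1.1.1.1.1.1.2) := setDef_of_var fun _ _ => rfl

instance TermDef.add {f g : Env M k → M.Num} [hf : TermDef f] [hg : TermDef g] :
    TermDef (fun e => f e + g e) := by
  refine ⟨fun N => ?_⟩
  obtain ⟨N₁, h₁, s, p, P, hs, hs', hs''⟩ := hf.out N
  obtain ⟨N₂, h₂, t, q, Q, ht, ht', ht''⟩ := hg.out N₁
  refine ⟨N₂, by omega, s.add t, fun j => if j < N₁ then p j else q j,
    fun j => if j < N₁ then P j else Q j, ?_, ?_, fun v V h => ?_⟩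
  · simp only [Term.nums, Finset.mem_union]; grind
  · simp only [Term.sets, Finset.mem_union]; grind
  · obtain ⟨ha, hb⟩ := h.split h₁ h₂
    exact congrArg₂ M.add (hs'' v V ha) (ht'' v V hb)

instance TermDef.mul {f g : Env M k → M.Num} [hf : TermDef f] [hg : TermDef g] :
    TermDef (fun e => f e * g e) := by
  refine ⟨fun N => ?_⟩
  obtain ⟨N₁, h₁, s, p, P, hs, hs', hs''⟩ := hf.out N
  obtain ⟨N₂, h₂, t, q, Q, ht, ht', ht''⟩ := hg.out N₁
  refine ⟨N₂, by omega, s.mul t, fun j => if j < N₁ then p j else q j,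
    fun j => if j < N₁ then P j else Q j, ?_, ?_, fun v V h => ?_⟩
  · simp only [Term.nums, Finset.mem_union]; grind
  · simp only [Term.sets, Finset.mem_union]; grind
  · obtain ⟨ha, hb⟩ := h.split h₁ h₂
    exact congrArg₂ M.mul (hs'' v V ha) (ht'' v V hb)

instance TermDef.const (c : M.Num) : TermDef (fun _ : Env M k => c) := ⟨fun N =>
  ⟨N + 1, by omega, .var (2 * N + 1), fun _ => c, fun _ => M.nonemptyStr.some,
    by simp [Term.nums], by simp [Term.sets],
    fun v V h => by simp [(h N le_rfl (by omega)).1]⟩⟩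

/-- Moves a definable function under one more quantifier; the defining term stays the same. It is
supplied by hand where an abstract function occurs below a binder. -/
theorem TermDef.weaken {f : Env M k → M.Num} (hf : TermDef f) :
    TermDef (fun e : Env M (k + 1) => f e.1) := by
  refine ⟨fun N => ?_⟩
  obtain ⟨N', h, t, p, P, hn, hs, ht⟩ := hf.out N
  exact ⟨N', h, t, p, P, fun x hx => (hn x hx).imp_right (by omega), hs, ht⟩

theorem SetDef.weaken {A : Env M k → M.Str} (hA : SetDef A) :
    SetDef (fun e : Env M (k + 1) => A e.1) := by
  refine ⟨fun N => ?_⟩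
  obtain ⟨N', h, Y, p, P, hY, ht⟩ := hA.out N
  exact ⟨N', h, Y, p, P, hY, ht⟩

/-! ### Closure of `Σ₀`-definability under connectives and bounded quantifiers -/

namespace Sigma0Def

instance eq {f g : Env M k → M.Num} [hf : TermDef f] [hg : TermDef g] :
    Sigma0Def (fun e => f e = g e) := by
  refine ⟨fun N => ?_⟩
  obtain ⟨N₁, h₁, s, p, P, hs, hs', hs''⟩ := hf.out N
  obtain ⟨N₂, h₂, t, q, Q, ht, ht', ht''⟩ := hg.out N₁
  refine ⟨N₂, by omega, .eqN s t, fun j => if j < N₁ then p j else q j,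
    fun j => if j < N₁ then P j else Q j, .eqN _ _, ?_, ?_, fun v V h => ?_⟩
  · simp only [Formula.freeN, Finset.mem_union]; grind
  · simp only [Formula.freeS, Finset.mem_union]; grind
  · obtain ⟨ha, hb⟩ := h.split h₁ h₂
    simp [hs'' v V ha, ht'' v V hb]

instance le {f g : Env M k → M.Num} [hf : TermDef f] [hg : TermDef g] :
    Sigma0Def (fun e => f e ≤ g e) := by
  refine ⟨fun N => ?_⟩
  obtain ⟨N₁, h₁, s, p, P, hs, hs', hs''⟩ := hf.out N
  obtain ⟨N₂, h₂, t, q, Q, ht, ht', ht''⟩ := hg.out N₁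
  refine ⟨N₂, by omega, .le s t, fun j => if j < N₁ then p j else q j,
    fun j => if j < N₁ then P j else Q j, .le _ _, ?_, ?_, fun v V h => ?_⟩
  · simp only [Formula.freeN, Finset.mem_union]; grind
  · simp only [Formula.freeS, Finset.mem_union]; grind
  · obtain ⟨ha, hb⟩ := h.split h₁ h₂
    simp [hs'' v V ha, ht'' v V hb]

instance mem {f : Env M k → M.Num} {A : Env M k → M.Str} [hf : TermDef f] [hA : SetDef A] :
    Sigma0Def (fun e => M.mem (f e) (A e)) := by
  refine ⟨fun N => ?_⟩
  obtain ⟨N₁, h₁, s, p, P, hs, hs', hs''⟩ := hf.out N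
  obtain ⟨N₂, h₂, Y, q, Q, hY, hY'⟩ := hA.out N₁
  refine ⟨N₂, by omega, .mem s Y, fun j => if j < N₁ then p j else q j,
    fun j => if j < N₁ then P j else Q j, .mem _ _, ?_, ?_, fun v V h => ?_⟩
  · simpa only [Formula.freeN] using hs
  · simp only [Formula.freeS, Finset.mem_insert]; grind
  · obtain ⟨ha, hb⟩ := h.split h₁ h₂
    simp [hs'' v V ha, hY' v V hb]

instance not {R : Env M k → Prop} [hR : Sigma0Def R] : Sigma0Def (fun e => ¬ R e) := by
  refine ⟨fun N => ?_⟩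
  obtain ⟨N₁, h₁, φ, p, P, hφ, hs, hs', hs''⟩ := hR.out N
  exact ⟨N₁, h₁, .not φ, p, P, hφ.not, hs, hs', fun v V h => by simp [hs'' v V h]⟩

instance and {R S : Env M k → Prop} [hR : Sigma0Def R] [hS : Sigma0Def S] :
    Sigma0Def (fun e => R e ∧ S e) := by
  refine ⟨fun N => ?_⟩
  obtain ⟨N₁, h₁, φ, p, P, hφ, hs, hs', hs''⟩ := hR.out N
  obtain ⟨N₂, h₂, ψ, q, Q, hψ, ht, ht', ht''⟩ := hS.out N₁
  refine ⟨N₂, by omega, .and φ ψ, fun j => if j < N₁ then p j else q j,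
    fun j => if j < N₁ then P j else Q j, hφ.and hψ, ?_, ?_, fun v V h => ?_⟩
  · simp only [Formula.freeN, Finset.mem_union]; grind
  · simp only [Formula.freeS, Finset.mem_union]; grind
  · obtain ⟨ha, hb⟩ := h.split h₁ h₂
    simp [hs'' v V ha, ht'' v V hb]

theorem congr {R S : Env M k → Prop} (hR : Sigma0Def R) (h : ∀ e, S e ↔ R e) : Sigma0Def S := by
  rwa [show S = R from funext fun e => propext (h e)]

instance or {R S : Env M k → Prop} [hR : Sigma0Def R] [hS : Sigma0Def S] :
    Sigma0Def (fun e => R e ∨ S e) :=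
  congr (inferInstance : Sigma0Def fun e => ¬ (¬ R e ∧ ¬ S e)) fun _ => by tauto

instance imp {R S : Env M k → Prop} [hR : Sigma0Def R] [hS : Sigma0Def S] :
    Sigma0Def (fun e => R e → S e) :=
  congr (inferInstance : Sigma0Def fun e => ¬ (R e ∧ ¬ S e)) fun _ => by tauto

instance iff {R S : Env M k → Prop} [hR : Sigma0Def R] [hS : Sigma0Def S] :
    Sigma0Def (fun e => R e ↔ S e) :=
  congr (inferInstance : Sigma0Def fun e => (R e → S e) ∧ (S e → R e)) fun _ => by tauto

instance exLe {f : Env M k → M.Num} {R : Env M k → M.Num → Prop} [hf : TermDef f]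
    [hR : Sigma0Def (fun e : Env M (k + 1) => R e.1 e.2)] :
    Sigma0Def (fun e => ∃ a, a ≤ f e ∧ R e a) := by
  refine ⟨fun N => ?_⟩
  obtain ⟨N₁, h₁, s, p, P, hs, hs', hs''⟩ := hf.out N
  obtain ⟨N₂, h₂, ψ, q, Q, hψ, ht, ht', ht''⟩ := hR.out N₁
  -- The variable `2 * k` is the one that `toEnv` reads as the last coordinate of an `Env M (k +
  -- 1)`; it is even, so it is no parameter.
  refine ⟨N₂, by omega, .exLe (2 * k) s ψ, fun j => if j < N₁ then p j else q j,
    fun j => if j < N₁ then P j else Q j, .exLe (fun h => ?_) hψ, ?_, ?_, fun v V h => ?_⟩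
  · have := hs _ h; omega
  · simp only [Formula.exLe, Formula.freeN, Finset.mem_union, Finset.mem_erase, Term.nums,
      Finset.mem_singleton]
    rintro x ⟨hx, (rfl | hx') | hx'⟩
    · exact absurd rfl hx
    · exact hs x hx'
    · have := ht x hx'; omega
  · simp only [Formula.exLe, Formula.freeS, Finset.mem_union, Term.sets]; grind
  · have hu (a : M.Num) : Agree N N₂ (fun j => if j < N₁ then p j else q j)
        (fun j => if j < N₁ then P j else Q j) (update v (2 * k) a) V := by
      intro j hj hj'
      rw [update_of_ne (by omega)]
      exact h j hj hj'
    simp only [Formula.exLe, sat_exN, sat_and, sat_le, eval_var, update_self]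
    refine exists_congr fun a => ?_
    obtain ⟨ha, hb⟩ := (hu a).split h₁ h₂
    rw [hs'' _ V ha, ht'' _ V hb, toEnv, toEnv_update_num le_rfl, update_self]

instance allLe {f : Env M k → M.Num} {R : Env M k → M.Num → Prop} [hf : TermDef f]
    [hR : Sigma0Def (fun e : Env M (k + 1) => R e.1 e.2)] :
    Sigma0Def (fun e => ∀ a, a ≤ f e → R e a) :=
  congr (inferInstance : Sigma0Def fun e => ¬ ∃ a, a ≤ f e ∧ ¬ R e a) fun _ => by simp

end Sigma0Def

/-! ## Models of `V¹`: comprehension and induction -/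

/-- Models of `V¹`. -/
class V1Model (M : Struct) : Prop where
  models : ∀ ψ ∈ V1, M.Models ψ

variable [V1Model M]

theorem exists_set_of_sigma0 (R : M.Num → Prop) (z : M.Num)
    (hR : Sigma0Def (fun e : Env M 1 => R e.2) := by infer_instance) : ∃ A : M.Str, M.len A ≤ z ∧ ∀ y, y ≤ z ∧ y ≠ z → (M.mem y A ↔ R y) := by
  obtain ⟨N, -, φ, p, P, hφ, hn, hs, hsat⟩ := hR.out 0
  have hX : N + 1 ∉ φ.freeS := fun h => by have := hs _ h; omega
  -- Number variables `0` and `2` are not parameters, and `N + 1` is the first set variable that `φ`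
  -- cannot mention. The assignment below inverts the placement of parameters in `Agree`.
  have h := V1Model.models _ (V1.comp (φ := φ) 0 2 (N + 1) hφ (by omega) hX)
    (fun i => p (i / 2)) (fun j => P (j - 1)) z
  simp only [Formula.exSLe, sat_exS, sat_and, sat_le, eval_len, update_self, eval_var, sat_allN,
    sat_imp, sat_not, sat_eqN, sat_iff, sat_mem, ne_eq, OfNat.ofNat_ne_zero, not_false_eq_true,
    update_of_ne] at h
  obtain ⟨A, hA, h⟩ := h
  refine ⟨A, hA, fun y hy => (h y hy).trans ((hsat _ _ ?_).trans ?_)⟩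
  · intro j _ hj
    rw [update_of_ne (by omega), update_of_ne (by omega), update_of_ne (by omega)]
    exact ⟨congrArg p (by omega), rfl⟩
  · simp [toEnv]

theorem sigma1_induction (R : M.Num → M.Str → Prop) {Z : M.Num}
    (h₀ : ∃ A, M.len A ≤ Z ∧ R 0 A)
    (h₁ : ∀ x, (∃ A, M.len A ≤ Z ∧ R x A) → ∃ A, M.len A ≤ Z ∧ R (x + 1) A) (x : M.Num)
    (hR : Sigma0Def (fun e : Env M 1 => R e.2 e.1.2) := by infer_instance) :
    ∃ A, M.len A ≤ Z ∧ R x A := by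
  obtain ⟨N, -, φ, p, P, hφ, hn, hs, hsat⟩ := hR.out 0
  let v : ℕ → M.Num := fun i => if i = 2 * N + 1 then Z else p (i / 2)
  let V : ℕ → M.Str := fun j => P (j - 1)
  -- The bound `Z` becomes one more parameter, in the first odd variable after those used by `φ`;
  -- set variable `0` is the witness.
  let ψ : Formula := .exSLe 0 (.var (2 * N + 1)) φ
  have hψ : IsSigma1 ψ := .exSLe (by simp [Term.sets]) (.base _ hφ)
  have hy : 2 ∉ ψ.freeN := by
    simp only [ψ, Formula.exSLe, Formula.freeN, Term.nums, Finset.mem_union, Finset.mem_singleton,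
      Finset.notMem_empty, false_or]
    rintro (h | h)
    · omega
    · have := hn _ h; omega
  have key (w : ℕ → M.Num) (hw : ∀ i, i % 2 = 1 → w i = v i) :
      ψ.Sat M w V ↔ ∃ A, M.len A ≤ Z ∧ R (w 0) A := by
    simp only [ψ, Formula.exSLe, sat_exS, sat_and, sat_le, eval_len, eval_var, update_self]
    refine exists_congr fun A => and_congr ?_ ?_
    · rw [hw _ (by omega)]; simp [v]
    · rw [hsat]
      · simp [toEnv]
      · intro j _ hj
        rw [hw _ (by omega), update_of_ne (by omega)]
        refine ⟨?_, rfl⟩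
        simp only [v]
        rw [if_neg (by omega)]
        exact congrArg p (by omega)
  have h := V1Model.models _ (V1.ind (φ := ψ) 0 2 hψ (by omega) hy) v V
  simp only [indAxiom, sat_imp, sat_and, sat_allN, sat_eqN, eval_var, update_self, eval_zero,
    eval_add, eval_one, forall_eq, ne_eq, OfNat.ofNat_ne_zero, not_false_eq_true, update_of_ne] at h
  have hw (a : M.Num) : ∀ i, i % 2 = 1 → update v 0 a i = v i :=
    fun i hi => update_of_ne (by omega) _ _
  have hw' (a b : M.Num) : ∀ i, i % 2 = 1 → update (update v 2 b) 0 a i = v i :=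
    fun i hi => by rw [update_of_ne (by omega), update_of_ne (by omega)]
  have h := h ⟨?_, ?_⟩ x
  · rw [key _ (hw x)] at h
    simpa using h
  · rw [key _ (hw 0)]
    simpa using h₀
  · intro b hb
    rw [key _ (hw' _ _)] at hb ⊢
    simp only [update_self] at hb ⊢
    exact h₁ b hb

theorem sigma0_induction (R : M.Num → Prop) (h₀ : R 0) (h₁ : ∀ x, R x → R (x + 1)) (x : M.Num)
    (hR : Sigma0Def (fun e : Env M 1 => R e.2) := by infer_instance) : R x := by
  -- Any set of length at most `0` serves as a dummy witness for the set quantifier.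
  obtain ⟨B, hB, -⟩ := exists_set_of_sigma0 (M := M) (fun x => x = x) 0
  obtain ⟨-, -, h⟩ := sigma1_induction (M := M) (fun x _ => R x) (Z := 0) ⟨B, hB, h₀⟩
    (fun x ⟨A, hA, h⟩ => ⟨A, hA, h₁ x h⟩) x
  exact h

end Definability

/-! ## Satisfaction of formulas written by builders -/

section Builders

variable {M : Struct} (v : ℕ → M.Num) (V : ℕ → M.Str) (d : ℕ)

@[simp] theorem sat_sentence (φ : Builder) : (sentence φ).Sat M v V ↔ (φ 0).Sat M v V := Iff.rfl
@[simp] theorem bsat_eqN (s t : Term) :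
    ((s ≐ t) d).Sat M v V ↔ s.eval M v V = t.eval M v V := Iff.rfl
@[simp] theorem bsat_le (s t : Term) :
    ((s ≼ t) d).Sat M v V ↔ s.eval M v V ≤ t.eval M v V := Iff.rfl
@[simp] theorem bsat_mem (t : Term) (X : ℕ) :
    (mem t X d).Sat M v V ↔ M.mem (t.eval M v V) (V X) := Iff.rfl
@[simp] theorem bsat_neg (φ : Builder) : (∼φ d).Sat M v V ↔ ¬ (φ d).Sat M v V := Iff.rfl
@[simp] theorem bsat_conj (φ ψ : Builder) :
    ((φ ⩓ ψ) d).Sat M v V ↔ (φ d).Sat M v V ∧ (ψ d).Sat M v V := Iff.rfl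
@[simp] theorem bsat_disj (φ ψ : Builder) :
    ((φ ⩔ ψ) d).Sat M v V ↔ (φ d).Sat M v V ∨ (ψ d).Sat M v V := Iff.rfl
@[simp] theorem bsat_impl (φ ψ : Builder) :
    ((φ ⟹ ψ) d).Sat M v V ↔ ((φ d).Sat M v V → (ψ d).Sat M v V) := sat_imp v V _ _
@[simp] theorem bsat_equi (φ ψ : Builder) :
    ((φ ⟺ ψ) d).Sat M v V ↔ ((φ d).Sat M v V ↔ (ψ d).Sat M v V) := sat_iff v V _ _
@[simp] theorem bsat_exN (f : Term → Builder) :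
    (exN f d).Sat M v V ↔ ∃ a, (f (.var d) (d + 1)).Sat M (update v d a) V := Iff.rfl
@[simp] theorem bsat_allN (f : Term → Builder) :
    (allN f d).Sat M v V ↔ ∀ a, (f (.var d) (d + 1)).Sat M (update v d a) V := Iff.rfl
@[simp] theorem bsat_exS (f : ℕ → Builder) :
    (exS f d).Sat M v V ↔ ∃ A, (f d (d + 1)).Sat M v (update V d A) := Iff.rfl
@[simp] theorem bsat_allS (f : ℕ → Builder) :
    (allS f d).Sat M v V ↔ ∀ A, (f d (d + 1)).Sat M v (update V d A) := Iff.rfl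

theorem bsat_allLe (t : Term) (f : Term → Builder) : (allLe t f d).Sat M v V ↔
    ∀ a, a ≤ t.eval M (update v d a) V → (f (.var d) (d + 1)).Sat M (update v d a) V := by
  simp [allLe]

theorem bsat_exSLe (t : Term) (f : ℕ → Builder) : (exSLe t f d).Sat M v V ↔
    ∃ A, M.len A ≤ t.eval M v (update V d A) ∧ (f d (d + 1)).Sat M v (update V d A) := by
  simp [exSLe]

end Builders

/-! ## Arithmetic in models of `V¹` -/

section Arithmetic

variable {M : Struct} [V1Model M]

theorem Basic2.sat {φ : Formula} (h : Basic2 φ) :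
    φ.Sat M (fun _ => 0) (fun _ => M.nonemptyStr.some) :=
  V1Model.models _ (V1.basic h) _ _

theorem num_add_one_ne_zero (x : M.Num) : x + 1 ≠ 0 := by
  simpa using Basic2.B1.sat (M := M) x
theorem num_add_one_inj (x y : M.Num) : x + 1 = y + 1 → x = y := by
  simpa using Basic2.B2.sat (M := M) x y
theorem num_add_zero (x : M.Num) : x + 0 = x := by
  simpa using Basic2.B3.sat (M := M) x
theorem num_add_succ (x y : M.Num) : x + (y + 1) = (x + y) + 1 := by
  simpa using Basic2.B4.sat (M := M) x y
theorem num_mul_zero (x : M.Num) : x * 0 = 0 := by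
  simpa using Basic2.B5.sat (M := M) x
theorem num_mul_succ (x y : M.Num) : x * (y + 1) = x * y + x := by
  simpa using Basic2.B6.sat (M := M) x y
theorem num_le_antisymm (x y : M.Num) : x ≤ y → y ≤ x → x = y := by
  simpa using Basic2.B7.sat (M := M) x y
theorem num_le_add (x y : M.Num) : x ≤ x + y := by
  simpa using Basic2.B8.sat (M := M) x y
theorem num_zero_le (x : M.Num) : 0 ≤ x := by
  simpa using Basic2.B9.sat (M := M) x
theorem num_le_total (x y : M.Num) : x ≤ y ∨ y ≤ x := by
  simpa using Basic2.B10.sat (M := M) x y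
theorem num_le_iff (x y : M.Num) : x ≤ y ↔ x ≤ y + 1 ∧ x ≠ y + 1 := by
  simpa [lt] using Basic2.B11.sat (M := M) x y
theorem num_exists_pred (x : M.Num) (h : x ≠ 0) : ∃ y ≤ x, y + 1 = x := by
  simpa [exLe, h] using Basic2.B12.sat (M := M) x
theorem num_mem_len (A : M.Str) (y : M.Num) (h : M.mem y A) : y ≤ M.len A ∧ y ≠ M.len A := by
  simpa [lt, h] using Basic2.L1.sat (M := M) A y

/-! ### Semiring laws by induction -/

theorem num_zero_add (x : M.Num) : 0 + x = x :=
  sigma0_induction (M := M) (fun x => 0 + x = x) (num_add_zero 0)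
    (fun x h => by rw [num_add_succ, h]) x

theorem num_add_assoc (x y z : M.Num) : x + y + z = x + (y + z) :=
  sigma0_induction (M := M) (fun z => x + y + z = x + (y + z)) (by simp only [num_add_zero])
    (fun z h => by simp only [num_add_succ, h]) z

theorem num_succ_add (x y : M.Num) : x + 1 + y = x + y + 1 :=
  sigma0_induction (M := M) (fun y => x + 1 + y = x + y + 1) (by simp only [num_add_zero])
    (fun z h => by simp only [num_add_succ, h]) y

theorem num_add_comm (x y : M.Num) : x + y = y + x :=
  sigma0_induction (M := M) (fun y => x + y = y + x) (by simp only [num_add_zero, num_zero_add])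
    (fun z h => by simp only [num_add_succ, num_succ_add, h]) y

theorem num_zero_mul (x : M.Num) : 0 * x = 0 :=
  sigma0_induction (M := M) (fun x => 0 * x = 0) (num_mul_zero 0)
    (fun x h => by rw [num_mul_succ, h, num_add_zero]) x

theorem num_mul_add (x y z : M.Num) : x * (y + z) = x * y + x * z :=
  sigma0_induction (M := M) (fun z => x * (y + z) = x * y + x * z)
    (by simp only [num_add_zero, num_mul_zero])
    (fun z h => by rw [num_add_succ, num_mul_succ, h, num_mul_succ, num_add_assoc]) z

theorem num_succ_mul (x y : M.Num) : (x + 1) * y = x * y + y :=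
  sigma0_induction (M := M) (fun y => (x + 1) * y = x * y + y)
    (by simp only [num_add_zero, num_mul_zero])
    (fun z h => by
      rw [num_mul_succ, h, num_mul_succ, ← num_add_assoc, ← num_add_assoc,
        num_add_assoc (x * z) z x, num_add_comm z x, ← num_add_assoc]) y

theorem num_mul_comm (x y : M.Num) : x * y = y * x :=
  sigma0_induction (M := M) (fun y => x * y = y * x) (by simp only [num_mul_zero, num_zero_mul])
    (fun z h => by simp only [num_mul_succ, num_succ_mul, h]) y

theorem num_mul_assoc (x y z : M.Num) : x * y * z = x * (y * z) :=
  sigma0_induction (M := M) (fun z => x * y * z = x * (y * z)) (by simp only [num_mul_zero])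
    (fun z h => by rw [num_mul_succ, num_mul_succ, num_mul_add, h]) z

theorem num_one_mul (x : M.Num) : 1 * x = x := by
  rw [← num_zero_add (1 : M.Num), num_succ_mul, num_zero_mul, num_zero_add]

instance : CommSemiring M.Num where
  add_assoc := num_add_assoc
  zero_add := num_zero_add
  add_zero := num_add_zero
  add_comm := num_add_comm
  mul_assoc := num_mul_assoc
  one_mul := num_one_mul
  mul_one x := by rw [num_mul_comm, num_one_mul]
  mul_comm := num_mul_comm
  zero_mul := num_zero_mul
  mul_zero := num_mul_zero
  left_distrib := num_mul_add
  right_distrib x y z := by rw [num_mul_comm, num_mul_add, num_mul_comm z x, num_mul_comm z y]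
  nsmul := nsmulRec

/-! ### Differences, cancellation and the linear order -/

theorem num_exists_of_le {x y : M.Num} (h : x ≤ y) : ∃ z ≤ y, x + z = y := by
  revert h
  refine sigma0_induction (M := M) (fun y => x ≤ y → ∃ z ≤ y, x + z = y) (fun h => ?_)
    (fun y ih h => ?_) y
  · exact ⟨0, num_zero_le 0, by rw [num_add_zero]; exact num_le_antisymm _ _ h (num_zero_le x)⟩
  · by_cases hx : x = y + 1
    · exact ⟨0, num_zero_le _, by rw [num_add_zero, hx]⟩
    · obtain ⟨z, -, rfl⟩ := ih ((num_le_iff x y).2 ⟨h, hx⟩)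
      refine ⟨z + 1, ?_, (add_assoc _ _ _).symm⟩
      rw [show x + z + 1 = (z + 1) + x by ring]
      exact num_le_add _ _

theorem num_add_right_cancel (x y z : M.Num) : x + z = y + z → x = y :=
  sigma0_induction (M := M) (fun z => x + z = y + z → x = y) (by simp)
    (fun z ih h => ih (num_add_one_inj _ _ (by rw [add_assoc, add_assoc]; exact h))) z

open Classical in
noncomputable instance : LinearOrder M.Num where
  le_refl x := by simpa using num_le_add x 0
  le_trans x y z hxy hyz := by
    obtain ⟨a, -, rfl⟩ := num_exists_of_le hxy
    obtain ⟨b, -, rfl⟩ := num_exists_of_le hyz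
    rw [add_assoc]
    exact num_le_add _ _
  le_antisymm := num_le_antisymm
  le_total := num_le_total
  toDecidableLE := inferInstance

instance : IsOrderedAddMonoid M.Num where
  add_le_add_left x y h z := by
    obtain ⟨a, -, rfl⟩ := num_exists_of_le h
    rw [show x + a + z = x + z + a by ring]
    exact num_le_add _ _

instance : IsCancelAdd M.Num := 
  have : IsRightCancelAdd M.Num := ⟨fun z x y h => num_add_right_cancel x y z h⟩
  AddCommMagma.IsRightCancelAdd.toIsCancelAdd M.Num

instance : CanonicallyOrderedAdd M.Num where
  exists_add_of_le h := by
    obtain ⟨z, -, h⟩ := num_exists_of_le h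
    exact ⟨z, h.symm⟩
  le_add_self x y := by rw [add_comm]; exact num_le_add x y
  le_self_add x y := num_le_add x y

instance : Nontrivial M.Num :=
  ⟨⟨0, 1, fun h => num_add_one_ne_zero (0 : M.Num) (by rw [zero_add, ← h])⟩⟩

theorem num_lt_iff (x y : M.Num) : x < y ↔ x ≤ y ∧ x ≠ y := lt_iff_le_and_ne

theorem num_lt_succ_iff {x y : M.Num} : x < y + 1 ↔ x ≤ y := by
  rw [num_lt_iff, ← num_le_iff]

theorem num_succ_le_iff {x y : M.Num} : x + 1 ≤ y ↔ x < y := by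
  rw [← not_lt, num_lt_succ_iff, not_le]

instance : IsOrderedRing M.Num := CanonicallyOrderedAdd.toIsOrderedRing

section Sigma0

variable {k : ℕ}

instance Sigma0Def.lt {f g : Env M k → M.Num} [hf : TermDef f] [hg : TermDef g] :
    Sigma0Def (fun e => f e < g e) :=
  congr (inferInstance : Sigma0Def fun e => f e ≤ g e ∧ ¬ f e = g e) fun _ => num_lt_iff _ _

instance Sigma0Def.exLt {f : Env M k → M.Num} {R : Env M k → M.Num → Prop} [hf : TermDef f]
    [hR : Sigma0Def (fun e : Env M (k + 1) => R e.1 e.2)] :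
    Sigma0Def (fun e => ∃ a, a < f e ∧ R e a) :=
  have := hf.weaken
  congr (inferInstance : Sigma0Def fun e => ∃ a, a ≤ f e ∧ a < f e ∧ R e a) fun _ =>
    exists_congr fun _ => ⟨fun h => ⟨h.1.le, h⟩, fun h => h.2⟩

instance Sigma0Def.allLt {f : Env M k → M.Num} {R : Env M k → M.Num → Prop} [hf : TermDef f]
    [hR : Sigma0Def (fun e : Env M (k + 1) => R e.1 e.2)] :
    Sigma0Def (fun e => ∀ a, a < f e → R e a) :=
  congr (inferInstance : Sigma0Def fun e => ¬ ∃ a, a < f e ∧ ¬ R e a) fun _ => by simp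

end Sigma0

theorem mem_lt_len {A : M.Str} {y : M.Num} (h : M.mem y A) : y < M.len A :=
  (num_lt_iff _ _).2 (num_mem_len A y h)

/-! ## The pairing function -/

theorem exists_half (x : M.Num) : ∃ h ≤ x * (x + 1), h + h = x * (x + 1) := by
  refine sigma0_induction (M := M) (fun x => ∃ h ≤ x * (x + 1), h + h = x * (x + 1))
    ⟨0, zero_le, by simp⟩ ?_ x
  rintro x ⟨h, -, hx⟩
  have : h + (x + 1) + (h + (x + 1)) = (x + 1) * (x + 1 + 1) := by
    rw [show h + (x + 1) + (h + (x + 1)) = h + h + (x + x + 1 + 1) by ring, hx]; ring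
  exact ⟨h + (x + 1), this ▸ le_self_add, this⟩

theorem exists_pair (x y : M.Num) : ∃ z : M.Num, z + z = (x + y) * (x + y + 1) + (y + y) := by
  obtain ⟨h, -, hh⟩ := exists_half (x + y)
  exact ⟨h + y, by rw [← hh]; ring⟩

/-- The pairing function. -/
noncomputable def pr (x y : M.Num) : M.Num := (exists_pair x y).choose

theorem pr_add_pr (x y : M.Num) : pr x y + pr x y = (x + y) * (x + y + 1) + (y + y) :=
  (exists_pair x y).choose_spec

theorem lt_of_add_self_lt {a b : M.Num} (h : a + a < b + b) : a < b :=
  lt_of_not_ge fun hab => h.not_ge (add_le_add hab hab)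

theorem eq_of_add_self_eq {a b : M.Num} (h : a + a = b + b) : a = b := by
  rcases lt_trichotomy a b with hab | hab | hab
  · exact absurd h (add_lt_add hab hab).ne
  · exact hab
  · exact absurd h (add_lt_add hab hab).ne'

theorem eq_pr_iff {x y z : M.Num} : z = pr x y ↔ z + z = (x + y) * (x + y + 1) + (y + y) :=
  ⟨fun h => h ▸ pr_add_pr x y, fun h => eq_of_add_self_eq (h.trans (pr_add_pr x y).symm)⟩

/-- This makes the bound on the quantifier in `withPair` harmless. -/
theorem pr_le (x y : M.Num) : pr x y ≤ (x + y) * (x + y + 1) + y := by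
  have h := pr_add_pr x y
  have hy : y ≤ pr x y := le_of_not_gt fun hlt =>
    (add_lt_add hlt hlt).not_ge (h ▸ le_add_self)
  refine le_of_not_gt fun hlt => (add_lt_add_of_lt_of_le hlt hy).ne ?_
  rw [h]; ring

/-- The pairing enumerates the diagonals one after the other. Doubling avoids division by two, and
the difference of the doubled values is an explicit polynomial in `d`. -/
theorem pr_lt_of_add_lt {x y x' y' : M.Num} (h : x + y < x' + y') : pr x y < pr x' y' := by
  obtain ⟨d, hd⟩ := exists_add_of_le (num_succ_le_iff.2 h)
  apply lt_of_add_self_lt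
  have : pr x' y' + pr x' y' =
      pr x y + pr x y + (x + x + 1 + d * (x + y + (x + y) + 1 + 1 + 1 + d) + (y' + y')) + 1 := by
    rw [pr_add_pr, pr_add_pr, hd]; ring
  rw [this, num_lt_succ_iff]
  exact le_self_add

theorem pr_inj {x y x' y' : M.Num} (h : pr x y = pr x' y') : x = x' ∧ y = y' := by
  have hs : x + y = x' + y' := by
    rcases lt_trichotomy (x + y) (x' + y') with h' | h' | h'
    · exact absurd h (pr_lt_of_add_lt h').ne
    · exact h'
    · exact absurd h (pr_lt_of_add_lt h').ne'
  have hy : y = y' := by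
    apply eq_of_add_self_eq
    have := (pr_add_pr x y).symm.trans ((congrArg₂ (· + ·) h h).trans (pr_add_pr x' y'))
    rw [hs] at this
    exact add_left_cancel this
  subst hy
  exact ⟨add_right_cancel hs, rfl⟩

@[simp] theorem pr_inj_iff {x y x' y' : M.Num} : pr x y = pr x' y' ↔ x = x' ∧ y = y' :=
  ⟨pr_inj, fun h => by rw [h.1, h.2]⟩

section Sigma0

variable {k : ℕ} {f g h f' : Env M k → M.Num} {A : Env M k → M.Str}
  [hf : TermDef f] [hg : TermDef g] [hh : TermDef h] [hf' : TermDef f'] [hA : SetDef A]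

theorem exists_eq_pr {x y : M.Num} {R : M.Num → Prop} :
    R (pr x y) ↔ ∃ z ≤ (x + y) * (x + y + 1) + y,
      z + z = (x + y) * (x + y + 1) + (y + y) ∧ R z := by
  simp only [← eq_pr_iff]
  exact ⟨fun h => ⟨_, pr_le x y, rfl, h⟩, fun ⟨z, _, hz, h⟩ => hz ▸ h⟩

/-- `pr` is not a term, so its value is introduced by a bounded quantifier. The instances below
apply this once for each level of nested pairs that occurs. -/
theorem Sigma0Def.of_pr {R : Env M k → M.Num → Prop}
    (hR : Sigma0Def (fun e : Env M (k + 1) => R e.1 e.2)) :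
    Sigma0Def (fun e => R e (pr (f e) (g e))) :=
  have := hf.weaken
  have := hg.weaken
  congr (inferInstance : Sigma0Def fun e => ∃ z ≤ (f e + g e) * (f e + g e + 1) + g e,
    z + z = (f e + g e) * (f e + g e + 1) + (g e + g e) ∧ R e z) fun _ => exists_eq_pr

instance Sigma0Def.eq_pr : Sigma0Def (fun e => h e = pr (f e) (g e)) :=
  congr (inferInstance : Sigma0Def fun e =>
    h e + h e = (f e + g e) * (f e + g e + 1) + (g e + g e)) fun _ => eq_pr_iff

instance Sigma0Def.mem_pr : Sigma0Def (fun e => M.mem (pr (f e) (g e)) (A e)) :=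
  have := hA.weaken
  of_pr (R := fun e z => M.mem z (A e)) inferInstance

instance Sigma0Def.mem_pr_pr : Sigma0Def (fun e => M.mem (pr (f e) (pr (g e) (h e))) (A e)) :=
  have := hA.weaken
  have := hf.weaken
  of_pr (R := fun e z => M.mem (pr (f e) z) (A e)) inferInstance

instance Sigma0Def.mem_pr_pr_pr :
    Sigma0Def (fun e => M.mem (pr (pr (f' e) (f e)) (pr (g e) (h e))) (A e)) :=
  have := hA.weaken
  have := hg.weaken
  have := hh.weaken
  of_pr (R := fun e z => M.mem (pr z (pr (g e) (h e))) (A e)) inferInstance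

end Sigma0

/-! ## Sets of pairs, maxima -/

theorem exists_set (R : M.Num → Prop) (z : M.Num)
    (hR : Sigma0Def (fun e : Env M 1 => R e.2) := by infer_instance) :
    ∃ A : M.Str, M.len A ≤ z ∧ ∀ y, M.mem y A ↔ y < z ∧ R y := by
  obtain ⟨A, hA, h⟩ := exists_set_of_sigma0 R z hR
  refine ⟨A, hA, fun y => ⟨fun hy => ?_, fun hy => (h y ((num_lt_iff _ _).1 hy.1)).2 hy.2⟩⟩
  have hz := (mem_lt_len hy).trans_le hA
  exact ⟨hz, (h y ((num_lt_iff _ _).1 hz)).1 hy⟩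

/-- Comprehension for binary relations. The definability hypothesis has three number variables
because `R` is used below the code `z` and its two components. -/
theorem exists_rel (R : M.Num → M.Num → Prop) (b c Z : M.Num)
    (hZ : ∀ x < b, ∀ y < c, R x y → pr x y < Z)
    (hR : Sigma0Def (fun e : Env M 3 => R e.1.2 e.2) := by infer_instance) :
    ∃ A : M.Str, M.len A ≤ Z ∧ ∀ x y, M.mem (pr x y) A ↔ x < b ∧ y < c ∧ R x y := by
  obtain ⟨A, hA, h⟩ := exists_set (M := M) (fun z => ∃ x < b, ∃ y < c, z = pr x y ∧ R x y) Z
  refine ⟨A, hA, fun x y => (h _).trans ?_⟩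
  simp only [pr_inj_iff]
  constructor
  · rintro ⟨-, x', hx, y', hy, ⟨rfl, rfl⟩, h⟩
    exact ⟨hx, hy, h⟩
  · rintro ⟨hx, hy, h⟩
    exact ⟨hZ x hx y hy h, x, hx, y, hy, ⟨rfl, rfl⟩, h⟩

/-- `Σ₁`-induction as a maximum principle: if every witnessed `m < K` could be increased and `K`
itself were not witnessed, induction would reach `K`. Witnesses must obey one bound `Z` for all `m`.
-/
theorem exists_max (R : M.Num → M.Str → Prop) {Z : M.Num} (K : M.Num)
    (h₀ : ∃ A, M.len A ≤ Z ∧ R 0 A)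
    (hR : Sigma0Def (fun e : Env M 1 => R e.2 e.1.2) := by infer_instance) :
    ∃ m ≤ K, (∃ A, M.len A ≤ Z ∧ R m A) ∧
      (m = K ∨ ¬ ∃ A, M.len A ≤ Z ∧ R (m + 1) A) := by
  by_contra! hcon
  have key := sigma1_induction (M := M) (fun x A => x ≤ K → R x A) (Z := Z)
    (h₀.imp fun A h => ⟨h.1, fun _ => h.2⟩) (fun x ⟨A, hA, h⟩ => by
      by_cases hx : x + 1 ≤ K
      · have hx' := num_succ_le_iff.1 hx
        obtain ⟨-, B, hB, hR⟩ := hcon x hx'.le ⟨A, hA, h hx'.le⟩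
        exact ⟨B, hB, fun _ => hR⟩
      · exact ⟨A, hA, fun h => absurd h hx⟩) K
  obtain ⟨A, hA, h⟩ := key
  exact (hcon K le_rfl ⟨A, hA, h le_rfl⟩).1 rfl

end Arithmetic

set_option synthInstance.maxSize 2000
set_option synthInstance.maxHeartbeats 200000

/-! ## Connected components of definable graphs -/

section Components

variable {M : Struct} [V1Model M]

theorem pr_lt_pr {x y x' y' : M.Num} (hx : x ≤ x') (hy : y < y') : pr x y < pr x' y' :=
  pr_lt_of_add_lt (add_lt_add_of_le_of_lt hx hy)

/-- `A` enumerates the numbers below `N` in such a way that `r` comes first, and each of the next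
`m` entries has a `G`-edge to an earlier entry. -/
def IsTree (G : M.Num → M.Num → Prop) (N r m : M.Num) (A : M.Str) : Prop :=
  (∀ q < N, ∀ x < N, ∀ y < N, M.mem (pr q x) A → M.mem (pr q y) A → x = y) ∧
  (∀ x < N, ∃ q < N, M.mem (pr q x) A) ∧ M.mem (pr 0 r) A ∧
  ∀ q ≤ m, 0 < q → ∃ q' < q, ∃ x < N, ∃ y < N, M.mem (pr q x) A ∧ M.mem (pr q' y) A ∧ G x y

/-- `J` codes a sequence of length `s + 1` of numbers `≤ j` that starts with `j` and decreases
along `G`. -/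
def IsDescent (G : M.Num → M.Num → Prop) (j s : M.Num) (J : M.Str) : Prop :=
  (∀ p ≤ s, ∃ q ≤ j, M.mem (pr p q) J) ∧
  (∀ p ≤ s, ∀ q ≤ j, ∀ q' ≤ j, M.mem (pr p q) J → M.mem (pr p q') J → q = q') ∧
  M.mem (pr 0 j) J ∧
  ∀ p < s, ∀ q ≤ j, ∀ q' ≤ j, M.mem (pr p q) J → M.mem (pr (p + 1) q') J → q' < q ∧ G q q'

/-- `G` is `Σ₀`-definable with parameters. -/
class RelDef (G : M.Num → M.Num → Prop) : Prop where
  out : ∀ {k : ℕ} (f g : Env M k → M.Num) [TermDef f] [TermDef g],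
    Sigma0Def (fun e => G (f e) (g e))

theorem sigma0Def_isTree (G : M.Num → M.Num → Prop) [hG : RelDef G] (N r : M.Num) :
    Sigma0Def (fun e : Env M 1 => IsTree G N r e.2 e.1.2) := by
  have := @hG.out
  unfold IsTree
  infer_instance

theorem sigma0Def_isDescent (G : M.Num → M.Num → Prop) [hG : RelDef G] (j : M.Num) :
    Sigma0Def (fun e : Env M 1 => IsDescent G j e.2 e.1.2) := by
  have := @hG.out
  unfold IsDescent
  infer_instance

theorem exists_isTree_zero (G : M.Num → M.Num → Prop) {N r : M.Num} (hr : r < N) :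
    ∃ A, M.len A ≤ pr N N ∧ IsTree G N r 0 A := by
  -- The identity enumeration with `0` and `r` interchanged.
  obtain ⟨A, hA, h⟩ := exists_rel (M := M)
    (fun q x => q = 0 ∧ x = r ∨ q = r ∧ x = 0 ∨ ¬ q = 0 ∧ ¬ q = r ∧ x = q) N N (pr N N)
    (fun x hx y hy _ => pr_lt_pr hx.le hy)
  have h0 : 0 < N := zero_le.trans_lt hr
  refine ⟨A, hA, ?_, ?_, ?_, ?_⟩
  · simp only [h]; grind
  · simp only [h]
    intro x hx
    by_cases h1 : x = r
    · exact ⟨0, h0, by grind⟩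
    · by_cases h2 : x = 0
      · exact ⟨r, hr, by grind⟩
      · exact ⟨x, hx, by grind⟩
  · simp only [h]; grind
  · intro q hq hq'
    exact absurd hq hq'.not_ge

/-- The new vertex `y` already has a position `j > m` in the enumeration, so exchanging positions `m
+ 1` and `j` appends it to the tree. Enumerating all numbers below `N` makes counting arguments
unnecessary. -/
theorem IsTree.extend {G : M.Num → M.Num → Prop} {N r m : M.Num} {A : M.Str}
    (hA : IsTree G N r m A) (hr : r < N) (hm : m + 1 < N) {q₀ x y : M.Num} (hq₀ : q₀ ≤ m) (hx : x < N)
    (hqx : M.mem (pr q₀ x) A) (hy : y < N) (hyx : G y x) (hym : ∀ q ≤ m, ¬ M.mem (pr q y) A) :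
    ∃ B, M.len B ≤ pr N N ∧ IsTree G N r (m + 1) B := by
  obtain ⟨hfun, honto, hroot, htree⟩ := hA
  obtain ⟨j, hj, hjy⟩ := honto y hy
  have hmj : m < j := lt_of_not_ge fun h => hym j h hjy
  have hmm : m < m + 1 := num_lt_succ_iff.2 le_rfl
  obtain ⟨B, hB, h⟩ := exists_rel (M := M)
    (fun q z => q = m + 1 ∧ z = y ∨ q = j ∧ ¬ j = m + 1 ∧ M.mem (pr (m + 1) z) A ∨
      ¬ q = m + 1 ∧ ¬ q = j ∧ M.mem (pr q z) A) N N (pr N N)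
    (fun x hx y hy _ => pr_lt_pr hx.le hy)
  have hlow (q z : M.Num) (hq : q ≤ m) : M.mem (pr q z) B ↔ z < N ∧ M.mem (pr q z) A := by
    have h1 : q ≠ m + 1 := (hq.trans_lt hmm).ne
    have h2 : q ≠ j := (hq.trans_lt hmj).ne
    have h3 : q < N := hq.trans_lt (hmj.trans hj)
    simp [h, h1, h2, h3]
  refine ⟨B, hB, ?_, ?_, ?_, ?_⟩
  · simp only [h]; grind
  · intro z hz
    obtain ⟨q, hq, hqz⟩ := honto z hz
    by_cases h1 : q = m + 1
    · by_cases h2 : j = m + 1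
      · exact ⟨m + 1, hm, by rw [h]; grind⟩
      · exact ⟨j, hj, by rw [h]; grind⟩
    · by_cases h2 : q = j
      · exact ⟨m + 1, hm, by rw [h]; grind⟩
      · exact ⟨q, hq, by rw [h]; grind⟩
  · rw [hlow 0 r zero_le]
    exact ⟨hr, hroot⟩
  · intro q hq hq0
    rcases hq.lt_or_eq with hq | rfl
    · have hq := num_lt_succ_iff.1 hq
      obtain ⟨q', hq', z, hz, w, hw, h1, h2, h3⟩ := htree q hq hq0
      exact ⟨q', hq', z, hz, w, hw, (hlow _ _ hq).2 ⟨hz, h1⟩,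
        (hlow _ _ (hq'.le.trans hq)).2 ⟨hw, h2⟩, h3⟩
    · exact ⟨q₀, hq₀.trans_lt hmm, y, hy, x, hx, by rw [h]; grind, (hlow _ _ hq₀).2 ⟨hx, hqx⟩, hyx⟩

/-- The graph is transported to positions in the enumeration, where descents can be compared by
size. -/
theorem RelDef.comap (G : M.Num → M.Num → Prop) [hG : RelDef G] (N : M.Num) (A : M.Str) :
    RelDef (fun q q' => ∃ x < N, ∃ y < N, M.mem (pr q x) A ∧ M.mem (pr q' y) A ∧ G x y) := by
  refine ⟨fun f g hf hg => ?_⟩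
  have := @hG.out
  have := hf.weaken
  have := hg.weaken
  have := hf.weaken.weaken
  have := hg.weaken.weaken
  infer_instance

/-- Each step loses at least one. This bounds the length of a descent by its starting position and
so makes the resulting paths short. -/
theorem IsDescent.add_le {G : M.Num → M.Num → Prop} {j s : M.Num} {J : M.Str}
    (hJ : IsDescent G j s J) : ∀ p ≤ s, ∀ q ≤ j, M.mem (pr p q) J → p + q ≤ j := by
  refine sigma0_induction (M := M) (fun p => p ≤ s → ∀ q ≤ j, M.mem (pr p q) J → p + q ≤ j)
    (fun _ q hq _ => by rwa [zero_add]) (fun p ih hp q hq hpq => ?_)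
  have hp' := num_succ_le_iff.1 hp
  obtain ⟨q₀, hq₀, hpq₀⟩ := hJ.1 p hp'.le
  have h := (hJ.2.2.2 p hp' q₀ hq₀ q hq hpq₀ hpq).1
  calc p + 1 + q = p + (q + 1) := by ring
    _ ≤ p + q₀ := by gcongr; exact num_succ_le_iff.2 h
    _ ≤ j := ih hp'.le q₀ hq₀ hpq₀

theorem IsDescent.extend {G : M.Num → M.Num → Prop} {j s : M.Num} {J : M.Str}
    (hJ : IsDescent G j s J) (hs : s ≤ j) {q q' : M.Num} (hq : q ≤ j) (hsq : M.mem (pr s q) J)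
    (hq' : q' < q) (hG : G q q') :
    ∃ J', M.len J' ≤ pr (j + 2) (j + 1) ∧ IsDescent G j (s + 1) J' := by
  have hss : s < s + 1 := num_lt_succ_iff.2 le_rfl
  obtain ⟨J', hJ', h⟩ := exists_rel (M := M)
    (fun p y => p ≤ s ∧ M.mem (pr p y) J ∨ p = s + 1 ∧ y = q') (s + 1 + 1) (j + 1)
    (pr (j + 2) (j + 1)) (fun x hx y hy _ => pr_lt_pr (hx.le.trans (by
      rw [add_assoc, one_add_one_eq_two]; gcongr)) hy)
  have hlow (p y : M.Num) (hp : p ≤ s) : M.mem (pr p y) J' ↔ y ≤ j ∧ M.mem (pr p y) J := by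
    have h1 : p < s + 1 := hp.trans_lt hss
    have h2 : p < s + 1 + 1 := h1.trans (num_lt_succ_iff.2 le_rfl)
    simp [h, hp, h1.ne, h2, num_lt_succ_iff]
  have hlast (y : M.Num) : M.mem (pr (s + 1) y) J' ↔ y = q' := by
    have h2 : s + 1 < s + 1 + 1 := num_lt_succ_iff.2 le_rfl
    have h3 : q' ≤ j := hq'.le.trans hq
    have h4 := hss.not_ge
    rw [h]
    simp only [num_lt_succ_iff, le_rfl, true_and]
    grind
  refine ⟨J', hJ', fun p hp => ?_, fun p hp a ha b hb hpa hpb => ?_, ?_,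
    fun p hp a ha b hb hpa hpb => ?_⟩
  · rcases hp.lt_or_eq with hp | rfl
    · have hp := num_lt_succ_iff.1 hp
      obtain ⟨y, hy, hpy⟩ := hJ.1 p hp
      exact ⟨y, hy, (hlow p y hp).2 ⟨hy, hpy⟩⟩
    · exact ⟨q', hq'.le.trans hq, (hlast _).2 rfl⟩
  · rcases hp.lt_or_eq with hp | rfl
    · have hp := num_lt_succ_iff.1 hp
      exact hJ.2.1 p hp a ha b hb ((hlow p a hp).1 hpa).2 ((hlow p b hp).1 hpb).2
    · rw [(hlast a).1 hpa, (hlast b).1 hpb]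
  · exact (hlow 0 j zero_le).2 ⟨le_rfl, hJ.2.2.1⟩
  · have hp := num_lt_succ_iff.1 hp
    have hpa := ((hlow p a hp).1 hpa).2
    rcases hp.lt_or_eq with hp | rfl
    · exact hJ.2.2.2 p hp a ha b hb hpa ((hlow _ b (num_succ_le_iff.2 hp)).1 hpb).2
    · rw [hJ.2.1 p le_rfl a ha q hq hpa hsq, (hlast b).1 hpb]
      exact ⟨hq', hG⟩

/-- A sequence of numbers is coded by a set up to the index `s`. -/
def Codes (P : M.Str) (s : M.Num) (f : M.Num → M.Num) : Prop :=
  ∀ p ≤ s, ∀ y, M.mem (pr p y) P ↔ y = f p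

/-- A longest descent from position `j` must end at position `0`, where the root sits, because every
other tree entry has an edge to an earlier one. Reading off the entries gives the path. -/
theorem IsTree.exists_path {G : M.Num → M.Num → Prop} [hG : RelDef G] {N r m : M.Num} {A : M.Str}
    (hA : IsTree G N r m A) (hr : r < N) {j x : M.Num} (hj : j ≤ m) (hx : x < N)
    (hjx : M.mem (pr j x) A) (hm : m < N) :
    ∃ s < N, ∃ (P : M.Str) (f : M.Num → M.Num), Codes P s f ∧ f 0 = x ∧ f s = r ∧
      (∀ p ≤ s, f p < N) ∧ ∀ p < s, G (f p) (f (p + 1)) := by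
  have hG' := RelDef.comap G N A
  obtain ⟨J₀, hJ₀, h₀⟩ := exists_rel (M := M) (fun p q => p = 0 ∧ q = j) 1 (j + 1)
    (pr (j + 2) (j + 1)) (fun x hx y hy _ => pr_lt_pr
      (hx.le.trans (by rw [← one_add_one_eq_two, ← add_assoc]; exact le_add_self)) hy)
  have hinit : IsDescent
      (fun q q' => ∃ x < N, ∃ y < N, M.mem (pr q x) A ∧ M.mem (pr q' y) A ∧ G x y) j 0 J₀ := by
    have h01 : (0 : M.Num) < 1 := by simp
    have hjj : j < j + 1 := num_lt_succ_iff.2 le_rfl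
    simp only [IsDescent, h₀]
    refine ⟨fun p hp => ⟨j, le_rfl, ?_⟩, fun p hp q hq q' hq' h h' => h.2.2.2.trans h'.2.2.2.symm,
      ⟨h01, hjj, trivial, trivial⟩, fun p hp => absurd hp zero_le.not_gt⟩
    exact ⟨(le_antisymm hp zero_le).trans_lt h01, hjj, le_antisymm hp zero_le, rfl⟩
  -- The cap `j + 1` is never attained, since descents have length at most `j`; so the maximum found
  -- cannot be extended.
  obtain ⟨s, -, ⟨J, -, hJ⟩, hmax⟩ := exists_max (M := M)
    (IsDescent (fun q q' => ∃ x < N, ∃ y < N, M.mem (pr q x) A ∧ M.mem (pr q' y) A ∧ G x y) j)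
    (j + 1) ⟨J₀, hJ₀, hinit⟩ (sigma0Def_isDescent _ j)
  obtain ⟨hfun, -, hroot, htree⟩ := hA
  obtain ⟨q, hq, hsq⟩ := hJ.1 s le_rfl
  have hsj : s ≤ j := le_self_add.trans (hJ.add_le s le_rfl q hq hsq)
  have hjN : j < N := hj.trans_lt hm
  have hq0 : q = 0 := by
    by_contra hq0
    rcases hmax with rfl | hmax
    · exact (num_lt_succ_iff.2 le_rfl).not_ge hsj
    · obtain ⟨q', hq', h⟩ := htree q (hq.trans hj) (pos_iff_ne_zero.2 hq0)
      exact hmax (hJ.extend hsj hq hsq hq' h)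
  subst hq0
  have hval (q : M.Num) (hq : q ≤ j) : ∃ y < N, M.mem (pr q y) A := by
    rcases eq_or_ne q 0 with rfl | hq0
    · exact ⟨r, hr, hroot⟩
    · obtain ⟨q', -, z, hz, w, -, h, -⟩ := htree q (hq.trans hj) (pos_iff_ne_zero.2 hq0)
      exact ⟨z, hz, h⟩
  have hex : ∀ p, p ≤ s → ∃ y, y < N ∧ ∃ q ≤ j, M.mem (pr p q) J ∧ M.mem (pr q y) A := by
    intro p hp
    obtain ⟨q, hq, hpq⟩ := hJ.1 p hp
    obtain ⟨y, hy, hqy⟩ := hval q hq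
    exact ⟨y, hy, q, hq, hpq, hqy⟩
  choose! f hfN hf using hex
  have huniq (p : M.Num) (hp : p ≤ s) (y : M.Num) (hy : y < N)
      (h : ∃ q ≤ j, M.mem (pr p q) J ∧ M.mem (pr q y) A) : y = f p := by
    obtain ⟨q, hq, hpq, hqy⟩ := h
    obtain ⟨q', hq', hpq', hqy'⟩ := hf p hp
    obtain rfl := hJ.2.1 p hp q hq q' hq' hpq hpq'
    exact hfun q (hq.trans_lt hjN) y hy (f p) (hfN p hp) hqy hqy'
  -- `f` was chosen outside the model; `P` is its code inside, defined from `J` and `A` alone.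
  obtain ⟨P, -, hP⟩ := exists_rel (M := M)
    (fun p y => ∃ q ≤ j, M.mem (pr p q) J ∧ M.mem (pr q y) A) (s + 1) N (pr (s + 1) N)
    (fun x hx y hy _ => pr_lt_pr hx.le hy)
  refine ⟨s, hsj.trans_lt hjN, P, f, fun p hp y => ?_, ?_, ?_, hfN, fun p hp => ?_⟩
  · rw [hP]
    constructor
    · rintro ⟨-, hy, h⟩
      exact huniq p hp y hy h
    · rintro rfl
      exact ⟨num_lt_succ_iff.2 hp, hfN p hp, hf p hp⟩
  · exact (huniq 0 zero_le x hx ⟨j, le_rfl, hJ.2.2.1, hjx⟩).symm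
  · exact (huniq s le_rfl r hr ⟨0, hq, hsq, hroot⟩).symm
  · have hp' := num_succ_le_iff.2 hp
    obtain ⟨q, hq, hpq, hqy⟩ := hf p hp.le
    obtain ⟨q', hq', hpq', hqy'⟩ := hf (p + 1) hp'
    obtain ⟨-, z, hz, w, hw, h1, h2, h3⟩ := hJ.2.2.2 p hp q hq q' hq' hpq hpq'
    rwa [← huniq p hp.le z hz ⟨q, hq, hpq, h1⟩, ← huniq (p + 1) hp' w hw ⟨q', hq', hpq', h2⟩]

/-- The connected component of `r` in a definable graph on the numbers below `N`. -/
theorem exists_component (G : M.Num → M.Num → Prop) [hG : RelDef G] {N r : M.Num} (hr : r < N) :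
    ∃ C : M.Str, M.mem r C ∧ (∀ x y, M.mem x C → y < N → G y x → M.mem y C) ∧
      ∀ x, M.mem x C → ∃ s < N, ∃ (P : M.Str) (f : M.Num → M.Num), Codes P s f ∧ f 0 = x ∧
        f s = r ∧ (∀ p ≤ s, f p < N) ∧ ∀ p < s, G (f p) (f (p + 1)) := by
  obtain ⟨K, -, hK⟩ := num_exists_pred N (zero_le.trans_lt hr).ne'
  have hKN : K < N := hK ▸ num_lt_succ_iff.2 le_rfl
  obtain ⟨m, hmK, ⟨A, -, hA⟩, hmax⟩ := exists_max (M := M) (IsTree G N r) K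
    (exists_isTree_zero G hr) (sigma0Def_isTree G N r)
  obtain ⟨C, -, hC⟩ := exists_set (M := M) (fun x => ∃ q ≤ m, M.mem (pr q x) A) N
  refine ⟨C, (hC r).2 ⟨hr, 0, zero_le, hA.2.2.1⟩, fun x y hx hy hyx => ?_, fun x hx => ?_⟩
  · obtain ⟨hx, q, hq, hqx⟩ := (hC x).1 hx
    refine (hC y).2 ⟨hy, ?_⟩
    -- If `m = K = N - 1`, the tree holds every vertex. Otherwise a vertex `y` missed by it could be
    -- appended, against maximality.
    rcases hmax with rfl | hmax
    · obtain ⟨q, hq, hqy⟩ := hA.2.1 y hy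
      exact ⟨q, num_lt_succ_iff.1 (hK ▸ hq), hqy⟩
    · by_contra! hcon
      have hm : m < K := hmK.lt_of_ne fun h => by
        subst h
        obtain ⟨q, hq, hqy⟩ := hA.2.1 y hy
        exact hcon q (num_lt_succ_iff.1 (hK ▸ hq)) hqy
      exact hmax (hA.extend hr ((num_succ_le_iff.2 hm).trans_lt hKN) hq hx hqx hy hyx hcon)
  · obtain ⟨hx, q, hq, hqx⟩ := (hC x).1 hx
    exact hA.exists_path hr hq hx hqx (hmK.trans_lt hKN)

end Components

/-! ## The meaning of the formulas about instances -/

section Semantics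

variable {M : Struct} [V1Model M] {v : ℕ → M.Num} {V : ℕ → M.Str} {d : ℕ}

theorem bsat_exLt (t : Term) (f : Term → Builder) : (exLt t f d).Sat M v V ↔
    ∃ a, a < t.eval M (update v d a) V ∧ (f (.var d) (d + 1)).Sat M (update v d a) V := by
  simp [exLt, exLe, num_lt_iff, and_assoc]

theorem bsat_allLt (t : Term) (f : Term → Builder) : (allLt t f d).Sat M v V ↔
    ∀ a, a < t.eval M (update v d a) V → (f (.var d) (d + 1)).Sat M (update v d a) V := by
  simp [allLt, allLe, num_lt_iff]

theorem bsat_isPair (z x y : Term) :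
    (isPair z x y d).Sat M v V ↔ z.eval M v V = pr (x.eval M v V) (y.eval M v V) := by
  simp [isPair, eq_pr_iff]

theorem bsat_withPair (x y : Term) (f : Term → Builder) : (withPair x y f d).Sat M v V ↔
    ∃ a, a = pr (x.eval M (update v d a) V) (y.eval M (update v d a) V) ∧
      (f (.var d) (d + 1)).Sat M (update v d a) V := by
  simp only [withPair, exLe, bsat_exN, bsat_conj, bsat_le, bsat_isPair, eval_var, update_self,
    eval_add, eval_mul, eval_one]
  exact exists_congr fun a => ⟨fun h => h.2, fun h => ⟨h.1.trans_le (pr_le _ _), h⟩⟩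

theorem bsat_rel (R : ℕ) (x y : Term) : (rel R x y d).Sat M v V ↔
    ∃ a, a = pr (x.eval M (update v d a) V) (y.eval M (update v d a) V) ∧ M.mem a (V R) := by
  simp [rel, bsat_withPair]

/-- `H` codes a map from `{0, …, s - 1}` to `B`. -/
def MapSem (s : M.Num) (B : M.Str) (m : M.Num) (H : M.Str) : Prop :=
  (∀ i < s, ∃ j < m, M.mem j B ∧ M.mem (pr i j) H) ∧
  ∀ i < s, ∀ j < m, ∀ j' < m, (M.mem j B ∧ M.mem j' B) ∧ M.mem (pr i j) H ∧ M.mem (pr i j') H →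
    j = j'

/-- `H` codes a homomorphism from `({0, …, s - 1}, E)` to `(B, EB)`. -/
def HomSem (s : M.Num) (E B EB : M.Str) (m : M.Num) (H : M.Str) : Prop :=
  MapSem s B m H ∧
  ∀ i < s, ∀ i' < s, ∀ j < m, ∀ j' < m,
    M.mem (pr i i') E ∧ M.mem (pr i j) H ∧ M.mem (pr i' j') H → M.mem (pr j j') EB

/-- `({0, …, t}, E)` is an undirected path. -/
def PathSem (t : M.Num) (E : M.Str) : Prop :=
  (∀ i < t, M.mem (pr i (i + 1)) E ∨ M.mem (pr (i + 1) i) E) ∧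
  ∀ i ≤ t, ∀ j ≤ t, ¬ j = i + 1 ∧ ¬ i = j + 1 → ¬ M.mem (pr i j) E ∧ ¬ M.mem (pr j i) E

/-- The meaning of the formula `Inst.linked`. -/
def LinkedSem (n l : M.Num) (VX EX VA EA : M.Str) (a b i j : M.Num) : Prop :=
  ∃ t < n * l, ∃ E, M.len E ≤ (1 + 1 + 1 + 1) * (t * t) ∧ ∃ H, M.len H ≤ pr t n ∧
    PathSem t E ∧ HomSem (t + 1) E VX EX n H ∧
    (M.mem (pr 0 i) H ∧ M.mem (pr t j) H) ∧ ∃ H', M.len H' ≤ pr t (pr n l) ∧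
      HomSem (t + 1) E VA EA (pr n l) H' ∧
      (∀ k < n, ∀ p < t + 1, M.mem (pr p k) H →
        ∃ c < l, M.mem (pr k c) VA ∧ M.mem (pr p (pr k c)) H') ∧
      M.mem (pr 0 (pr i a)) H' ∧ M.mem (pr t (pr j b)) H'

/-- The indices are those the builders assign in the final sentence: `n, l` are `0, 1`, the four
sets `2` to `5`, and `i, a, b` are `6, 7, 8`. They agree in the hypothesis on linkedness and in the
conclusion. -/
theorem bsat_linked : (Inst.linked ⟨.var 0, .var 1, 2, 3, 4, 5⟩ (.var 7) (.var 8) (.var 6) (.var 6)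
    9).Sat M v V ↔ LinkedSem (v 0) (v 1) (V 2) (V 3) (V 4) (V 5) (v 7) (v 8) (v 6) (v 6) := by
  simp only [Inst.linked, Inst.lifts, Inst.exDom, Inst.dom, mapsToPair, isHom, isMap, isPath,
    fourSq, exists_eq_left, bsat_exLt, bsat_allLt, bsat_allLe, bsat_exSLe, bsat_withPair, bsat_rel, bsat_conj,
    bsat_impl, bsat_disj, bsat_neg, bsat_mem, bsat_eqN, eval_add, eval_mul, eval_one, eval_zero,
    eval_var, update_self, update_apply, Nat.reduceEqDiff, reduceIte, Nat.reduceAdd,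
    OfNat.zero_ne_ofNat, OfNat.one_ne_ofNat]
  rfl

end Semantics

/-! ## Linkedness and connected components -/

section Linkedness

variable {M : Struct} [V1Model M] {n l : M.Num} {VX EX VA EA : M.Str}

/-- Vertices are renumbered as `k * l + c` because these numbers lie below `n * l`, so
`exists_component` yields exactly the path bound `t < n * l` that `Linked` demands. The codes `⟨k,
c⟩` can be larger. -/
theorem mul_add_inj {k c k' c' : M.Num} (hc : c < l) (hc' : c' < l)
    (h : k * l + c = k' * l + c') : k = k' ∧ c = c' := by
  have key {k c k' c' : M.Num} (hc : c < l) (hk : k < k') : k * l + c < k' * l + c' := calc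
    k * l + c < k * l + l := add_lt_add_right hc _
    _ = (k + 1) * l := by ring
    _ ≤ k' * l := mul_le_mul_left (num_succ_le_iff.2 hk) l
    _ ≤ _ := le_self_add
  rcases lt_trichotomy k k' with hk | rfl | hk
  · exact absurd h (key hc hk).ne
  · exact ⟨rfl, add_left_cancel h⟩
  · exact absurd h (key hc' hk).ne'

theorem mul_add_lt {k c : M.Num} (hk : k < n) (hc : c < l) : k * l + c < n * l := calc
  k * l + c < k * l + l := add_lt_add_right hc _
  _ = (k + 1) * l := by ring
  _ ≤ n * l := mul_le_mul_left (num_succ_le_iff.2 hk) l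

/-- The vertices `⟨i, a⟩` and `⟨j, b⟩` of the target digraph are joined by an edge that lies above
an edge of the input digraph. -/
def Step (EX VA EA : M.Str) (i a j b : M.Num) : Prop :=
  M.mem (pr i a) VA ∧ M.mem (pr j b) VA ∧
  (M.mem (pr i j) EX ∧ M.mem (pr (pr i a) (pr j b)) EA ∨
    M.mem (pr j i) EX ∧ M.mem (pr (pr j b) (pr i a)) EA)

/-- The relation `Step` with the vertex `⟨i, a⟩` renamed to `i * l + a`. -/
def StepRel (n l : M.Num) (EX VA EA : M.Str) (x y : M.Num) : Prop :=
  ∃ i < n, ∃ a < l, ∃ j < n, ∃ b < l, x = i * l + a ∧ y = j * l + b ∧ Step EX VA EA i a j b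

instance : RelDef (StepRel n l EX VA EA) := by
  refine ⟨fun f g hf hg => ?_⟩
  have := hf.weaken.weaken.weaken.weaken
  have := hg.weaken.weaken.weaken.weaken
  unfold StepRel Step
  infer_instance

/-- Edges of a path of length `s` fit below the bound `4 s²` imposed on its edge set. -/
theorem pr_succ_lt {p s : M.Num} (h : p + 1 ≤ s) :
    pr p (p + 1) < (1 + 1 + 1 + 1) * (s * s) ∧ pr (p + 1) p < (1 + 1 + 1 + 1) * (s * s) := by
  have hs : (1 + 1 + 1 + 1) * ((p + 1) * (p + 1)) ≤ (1 + 1 + 1 + 1) * (s * s) := by gcongr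
  constructor <;> refine lt_of_lt_of_le (lt_of_add_self_lt ?_) hs
  · rw [show (1 + 1 + 1 + 1) * ((p + 1) * (p + 1)) + (1 + 1 + 1 + 1) * ((p + 1) * (p + 1)) =
      pr p (p + 1) + pr p (p + 1) + (4 * p * p + 8 * p + 3) + 1 by rw [pr_add_pr]; ring]
    exact num_lt_succ_iff.2 le_self_add
  · rw [show (1 + 1 + 1 + 1) * ((p + 1) * (p + 1)) + (1 + 1 + 1 + 1) * ((p + 1) * (p + 1)) =
      pr (p + 1) p + pr (p + 1) p + (4 * p * p + 8 * p + 5) + 1 by rw [pr_add_pr]; ring]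
    exact num_lt_succ_iff.2 le_self_add

/-- The components of the vertices on the path give `H` and `H'`. Each edge of the abstract path is
oriented like an input edge and a target edge above it, so both maps are homomorphisms. -/
theorem linkedSem_of_path (hVX : ∀ i < n, M.mem i VX) {s : M.Num} {P : M.Str} {f : M.Num → M.Num}
    (hP : Codes P s f) (hs : s < n * l) {i a j b : M.Num} (ha : a < l) (hj : j < n)
    (hb : b < l) (hjb : M.mem (pr j b) VA) (h0 : f 0 = i * l + a) (hsf : f s = j * l + b)
    (hf : ∀ p < s, StepRel n l EX VA EA (f p) (f (p + 1))) :
    LinkedSem n l VX EX VA EA a b i j := by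
  have hex : ∀ p, p ≤ s → ∃ k c, k < n ∧ c < l ∧ f p = k * l + c ∧ M.mem (pr k c) VA := by
    intro p hp
    rcases hp.lt_or_eq with hp | rfl
    · obtain ⟨k, hk, c, hc, -, -, -, -, h, -, h', -⟩ := hf p hp
      exact ⟨k, c, hk, hc, h, h'⟩
    · exact ⟨j, b, hj, hb, hsf, hjb⟩
  choose! K C hK hC hKC hVA using hex
  have hstep (p : M.Num) (hp : p < s) : Step EX VA EA (K p) (C p) (K (p + 1)) (C (p + 1)) := by
    have hp' := num_succ_le_iff.2 hp
    obtain ⟨k, hk, c, hc, k', hk', c', hc', h, h', hst⟩ := hf p hp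
    obtain ⟨rfl, rfl⟩ := mul_add_inj hc (hC p hp.le) (h.symm.trans (hKC p hp.le))
    obtain ⟨rfl, rfl⟩ := mul_add_inj hc' (hC _ hp') (h'.symm.trans (hKC _ hp'))
    exact hst
  have hPK (p : M.Num) (hp : p ≤ s) (k c : M.Num) (hc : c < l) :
      M.mem (pr p (k * l + c)) P ↔ k = K p ∧ c = C p := by
    rw [hP p hp, hKC p hp]
    exact ⟨mul_add_inj hc (hC p hp), fun h => by rw [h.1, h.2]⟩
  let F (p : M.Num) : Prop := M.mem (pr (K p) (K (p + 1))) EX ∧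
    M.mem (pr (pr (K p) (C p)) (pr (K (p + 1)) (C (p + 1)))) EA
  -- `F` says that step `p` can be taken forwards, but mentions the external functions `K` and `C`.
  -- `F'` says the same through the code `P` and is therefore available for comprehension.
  let F' (p : M.Num) : Prop := ∃ k < n, ∃ c < l, ∃ k' < n, ∃ c' < l,
    M.mem (pr p (k * l + c)) P ∧ M.mem (pr (p + 1) (k' * l + c')) P ∧ M.mem (pr k k') EX ∧
      M.mem (pr (pr k c) (pr k' c')) EA
  have hF (p : M.Num) (hp : p < s) : F' p ↔ F p := by
    have hp' := num_succ_le_iff.2 hp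
    constructor
    · rintro ⟨k, hk, c, hc, k', hk', c', hc', h, h', h''⟩
      obtain ⟨rfl, rfl⟩ := (hPK p hp.le k c hc).1 h
      obtain ⟨rfl, rfl⟩ := (hPK _ hp' k' c' hc').1 h'
      exact h''
    · intro h
      exact ⟨K p, hK p hp.le, C p, hC p hp.le, K (p + 1), hK _ hp', C (p + 1), hC _ hp',
        (hPK p hp.le _ _ (hC p hp.le)).2 ⟨rfl, rfl⟩, (hPK _ hp' _ _ (hC _ hp')).2 ⟨rfl, rfl⟩, h⟩
  -- Exactly one orientation per step: forwards if possible, otherwise backwards, where `Step`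
  -- guarantees both edges.
  obtain ⟨E, hE, hEmem⟩ := exists_rel (M := M)
    (fun p p' => p' = p + 1 ∧ F' p ∨ p = p' + 1 ∧ ¬ F' p') (s + 1) (s + 1)
    ((1 + 1 + 1 + 1) * (s * s)) (by
      rintro p hp p' hp' (⟨rfl, -⟩ | ⟨rfl, -⟩)
      · exact (pr_succ_lt (num_lt_succ_iff.1 hp')).1
      · exact (pr_succ_lt (num_lt_succ_iff.1 hp)).2) (by simp only [F']; infer_instance)
  obtain ⟨H, hH, hHmem⟩ := exists_rel (M := M) (fun p k => ∃ c < l, M.mem (pr p (k * l + c)) P)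
    (s + 1) n (pr s n) (fun p hp k hk _ => pr_lt_pr (num_lt_succ_iff.1 hp) hk)
  obtain ⟨H', hH', hHmem'⟩ := exists_rel (M := M)
    (fun p w => ∃ k < n, ∃ c < l, w = pr k c ∧ M.mem (pr p (k * l + c)) P) (s + 1) (pr n l)
    (pr s (pr n l)) (fun p hp k hk _ => pr_lt_pr (num_lt_succ_iff.1 hp) hk)
  have hHK (p : M.Num) (hp : p ≤ s) (k : M.Num) : M.mem (pr p k) H ↔ k = K p := by
    rw [hHmem]
    constructor
    · rintro ⟨-, -, c, hc, h⟩
      exact ((hPK p hp k c hc).1 h).1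
    · rintro rfl
      exact ⟨num_lt_succ_iff.2 hp, hK p hp, C p, hC p hp, (hPK p hp _ _ (hC p hp)).2 ⟨rfl, rfl⟩⟩
  have hHK' (p : M.Num) (hp : p ≤ s) (w : M.Num) : M.mem (pr p w) H' ↔ w = pr (K p) (C p) := by
    rw [hHmem']
    constructor
    · rintro ⟨-, -, k, hk, c, hc, rfl, h⟩
      obtain ⟨rfl, rfl⟩ := (hPK p hp k c hc).1 h
      rfl
    · rintro rfl
      exact ⟨num_lt_succ_iff.2 hp, pr_lt_pr (hK p hp).le (hC p hp), K p, hK p hp, C p, hC p hp,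
        rfl, (hPK p hp _ _ (hC p hp)).2 ⟨rfl, rfl⟩⟩
  have hEF (p p' : M.Num) (h : M.mem (pr p p') E) :
      p' = p + 1 ∧ p < s ∧ F p ∨ p = p' + 1 ∧ p' < s ∧ ¬ F p' := by
    obtain ⟨hp, hp', ⟨rfl, hF'⟩ | ⟨rfl, hF'⟩⟩ := (hEmem p p').1 h
    · have hps := num_succ_le_iff.1 (num_lt_succ_iff.1 hp')
      exact .inl ⟨rfl, hps, (hF p hps).1 hF'⟩
    · have hps := num_succ_le_iff.1 (num_lt_succ_iff.1 hp)
      exact .inr ⟨rfl, hps, fun h' => hF' ((hF p' hps).2 h')⟩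
  obtain ⟨hi0, ha0⟩ := mul_add_inj ha (hC 0 zero_le) (h0.symm.trans (hKC 0 zero_le))
  obtain ⟨hjs, hbs⟩ := mul_add_inj hb (hC s le_rfl) (hsf.symm.trans (hKC s le_rfl))
  refine ⟨s, hs, E, hE, H, hH, ⟨fun p hp => ?_, fun p hp p' hp' hne => ?_⟩,
    ⟨⟨fun p hp => ?_, fun p hp k hk k' hk' h => ?_⟩, fun p hp p' hp' k hk k' hk' h => ?_⟩,
    ⟨(hHK 0 zero_le i).2 hi0, (hHK s le_rfl j).2 hjs⟩, H', hH',
    ⟨⟨fun p hp => ?_, fun p hp k hk k' hk' h => ?_⟩, fun p hp p' hp' k hk k' hk' h => ?_⟩,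
    fun k hk p hp h => ?_, (hHK' 0 zero_le _).2 (by rw [hi0, ha0]),
    (hHK' s le_rfl _).2 (by rw [hjs, hbs])⟩
  · have hp₁ := num_lt_succ_iff.2 hp.le
    have hp₂ := num_lt_succ_iff.2 (num_succ_le_iff.2 hp)
    by_cases h : F' p
    · exact .inl ((hEmem _ _).2 ⟨hp₁, hp₂, .inl ⟨rfl, h⟩⟩)
    · exact .inr ((hEmem _ _).2 ⟨hp₂, hp₁, .inr ⟨rfl, h⟩⟩)
  · constructor <;> intro h <;> rcases hEF _ _ h with ⟨h, -⟩ | ⟨h, -⟩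
    exacts [hne.1 h, hne.2 h, hne.2 h, hne.1 h]
  · have hp := num_lt_succ_iff.1 hp
    exact ⟨K p, hK p hp, hVX _ (hK p hp), (hHK p hp _).2 rfl⟩
  · have hp := num_lt_succ_iff.1 hp
    rw [(hHK p hp k).1 h.2.1, (hHK p hp k').1 h.2.2]
  · rw [(hHK p (num_lt_succ_iff.1 hp) k).1 h.2.1, (hHK p' (num_lt_succ_iff.1 hp') k').1 h.2.2]
    rcases hEF _ _ h.1 with ⟨rfl, -, h⟩ | ⟨rfl, hps, h⟩
    · exact h.1
    · exact ((hstep p' hps).2.2.resolve_left h).1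
  · have hp := num_lt_succ_iff.1 hp
    exact ⟨pr (K p) (C p), pr_lt_pr (hK p hp).le (hC p hp), hVA p hp, (hHK' p hp _).2 rfl⟩
  · have hp := num_lt_succ_iff.1 hp
    rw [(hHK' p hp k).1 h.2.1, (hHK' p hp k').1 h.2.2]
  · rw [(hHK' p (num_lt_succ_iff.1 hp) k).1 h.2.1, (hHK' p' (num_lt_succ_iff.1 hp') k').1 h.2.2]
    rcases hEF _ _ h.1 with ⟨rfl, -, h⟩ | ⟨rfl, hps, h⟩
    · exact h.2
    · exact ((hstep p' hps).2.2.resolve_left h).2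
  · have hp := num_lt_succ_iff.1 hp
    obtain rfl := (hHK p hp k).1 h
    exact ⟨C p, hC p hp, hVA p hp, (hHK' p hp _).2 rfl⟩

/-- Induction along the path: consecutive values of the lift are joined by a step, so the closed set
`C` is never left. -/
theorem LinkedSem.mem_of_mem {C : M.Str}
    (hC : ∀ x y, M.mem x C → y < n * l → StepRel n l EX VA EA y x → M.mem y C) {a b i j : M.Num}
    (hi : i < n) (ha : a < l) (hia : M.mem (pr i a) VA) (hj : j < n) (hb : b < l)
    (hjb : M.mem (pr j b) VA) (haC : M.mem (i * l + a) C)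
    (h : LinkedSem n l VX EX VA EA a b i j) : M.mem (j * l + b) C := by
  obtain ⟨t, -, E, -, H, -, hE, hH, ⟨hH0, hHt⟩, H', -, hH', hlift, hH0', hHt'⟩ := h
  have key : ∀ p ≤ t, ∃ k < n, ∃ c < l, M.mem (pr p k) H ∧ M.mem (pr k c) VA ∧
      M.mem (pr p (pr k c)) H' ∧ M.mem (k * l + c) C := by
    refine sigma0_induction (M := M) (fun p => p ≤ t → ∃ k < n, ∃ c < l, M.mem (pr p k) H ∧
      M.mem (pr k c) VA ∧ M.mem (pr p (pr k c)) H' ∧ M.mem (k * l + c) C)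
      (fun _ => ⟨i, hi, a, ha, hH0, hia, hH0', haC⟩) (fun p ih hp => ?_)
    have hpt := num_succ_le_iff.1 hp
    have hp₁ := num_lt_succ_iff.2 hpt.le
    have hp₂ := num_lt_succ_iff.2 hp
    obtain ⟨k, hk, c, hc, hpk, hkc, hpkc, hkcC⟩ := ih hpt.le
    obtain ⟨k', hk', -, hpk'⟩ := hH.1.1 (p + 1) hp₂
    obtain ⟨c', hc', hkc', hpkc'⟩ := hlift k' hk' (p + 1) hp₂ hpk'
    have hw := pr_lt_pr hk.le hc
    have hw' := pr_lt_pr hk'.le hc'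
    refine ⟨k', hk', c', hc', hpk', hkc', hpkc', hC _ _ hkcC (mul_add_lt hk' hc')
      ⟨k', hk', c', hc', k, hk, c, hc, rfl, rfl, hkc', hkc, ?_⟩⟩
    rcases hE.1 p hpt with h | h
    · exact .inr ⟨hH.2 _ hp₁ _ hp₂ _ hk _ hk' ⟨h, hpk, hpk'⟩,
        hH'.2 _ hp₁ _ hp₂ _ hw _ hw' ⟨h, hpkc, hpkc'⟩⟩
    · exact .inl ⟨hH.2 _ hp₂ _ hp₁ _ hk' _ hk ⟨h, hpk', hpk⟩,
        hH'.2 _ hp₂ _ hp₁ _ hw' _ hw ⟨h, hpkc', hpkc⟩⟩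
  obtain ⟨k, hk, c, hc, -, hkc, hpkc, hkcC⟩ := key t le_rfl
  -- The induction yields some value of `H'` at `t`; single-valuedness of `H'` identifies it with
  -- `⟨j, b⟩`.
  have h := hH'.1.2 t (num_lt_succ_iff.2 le_rfl) _ (pr_lt_pr hk.le hc) _ (pr_lt_pr hj.le hb)
    ⟨⟨hkc, hjb⟩, hpkc, hHt'⟩
  obtain ⟨rfl, rfl⟩ := pr_inj h
  exact hkcC

/-- `B` is a non-empty proper subset of `A`. -/
def ProperSem (B A : M.Str) : Prop :=
  (∀ i < M.len B, M.mem i B → M.mem i A) ∧ (∃ j < M.len B, M.mem j B) ∧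
    ∃ i < M.len A, M.mem i A ∧ ¬ M.mem i B

/-- The input digraph is fragmented. -/
def FragmentedSem (n : M.Num) (VX EX : M.Str) : Prop :=
  ∃ A, M.len A ≤ n ∧ ∃ B, M.len B ≤ n ∧ ProperSem A VX ∧ ProperSem B VX ∧
    (∀ i < n, (M.mem i A ↔ ¬ M.mem i B)) ∧
    ∀ i < n, ∀ j < n, M.mem i A ∧ M.mem j B → ¬ M.mem (pr i j) EX ∧ ¬ M.mem (pr j i) EX

/-- `1`-consistency. -/
def OneConsistentSem (n l : M.Num) (EX VA EA : M.Str) : Prop :=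
  ∀ i < n, ∀ a < l, M.mem (pr i a) VA → ∀ j < n,
    (M.mem (pr i j) EX → ∃ b < l, M.mem (pr j b) VA ∧ M.mem (pr (pr i a) (pr j b)) EA) ∧
    (M.mem (pr j i) EX → ∃ b < l, M.mem (pr j b) VA ∧ M.mem (pr (pr j b) (pr i a)) EA)

/-- Connectedness as an induction principle: a definable edge-closed property that holds somewhere
and fails somewhere would, with its complement, fragment the input digraph. -/
theorem forall_of_not_fragmented (hVX : ∀ i < n, M.mem i VX) (h : ¬ FragmentedSem n VX EX)
    (W : M.Num → Prop) (h₀ : ∃ i < n, W i)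
    (h₁ : ∀ i < n, ∀ j < n, M.mem (pr i j) EX ∨ M.mem (pr j i) EX → W i → W j)
    (hW : Sigma0Def (fun e : Env M 1 => W e.2) := by infer_instance) : ∀ i < n, W i := by
  by_contra! hcon
  obtain ⟨i₁, hi₁, hWi₁⟩ := hcon
  obtain ⟨i₀, hi₀, hWi₀⟩ := h₀
  obtain ⟨A, hA, hAmem⟩ := exists_set W n hW
  obtain ⟨B, hB, hBmem⟩ := exists_set (fun i => ¬ W i) n
  have hA₀ := (hAmem i₀).2 ⟨hi₀, hWi₀⟩
  have hB₁ := (hBmem i₁).2 ⟨hi₁, hWi₁⟩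
  refine h ⟨A, hA, B, hB, ⟨fun i _ hi => hVX i ((hAmem i).1 hi).1, ⟨i₀, mem_lt_len hA₀, hA₀⟩,
    i₁, mem_lt_len (hVX i₁ hi₁), hVX i₁ hi₁, fun h => hWi₁ ((hAmem i₁).1 h).2⟩,
    ⟨fun i _ hi => hVX i ((hBmem i).1 hi).1, ⟨i₁, mem_lt_len hB₁, hB₁⟩,
    i₀, mem_lt_len (hVX i₀ hi₀), hVX i₀ hi₀, fun h => ((hBmem i₀).1 h).2 hWi₀⟩,
    fun i hi => by rw [hAmem, hBmem]; tauto, fun i hi j hj hij => ?_⟩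
  have hWi := ((hAmem i).1 hij.1).2
  have hWj := ((hBmem j).1 hij.2).2
  exact ⟨fun h => hWj (h₁ i hi j hj (.inl h) hWi), fun h => hWj (h₁ i hi j hj (.inr h) hWi)⟩

/-- The step is given in both directions: one carries membership in `C` along, the other
non-membership. -/
theorem OneConsistentSem.exists_step (h : OneConsistentSem n l EX VA EA) {i a j : M.Num}
    (hi : i < n) (ha : a < l) (hia : M.mem (pr i a) VA) (hj : j < n)
    (hij : M.mem (pr i j) EX ∨ M.mem (pr j i) EX) :
    ∃ b < l, M.mem (pr j b) VA ∧ StepRel n l EX VA EA (i * l + a) (j * l + b) ∧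
      StepRel n l EX VA EA (j * l + b) (i * l + a) := by
  rcases hij with hij | hij
  · obtain ⟨b, hb, hjb, he⟩ := (h i hi a ha hia j hj).1 hij
    exact ⟨b, hb, hjb, ⟨i, hi, a, ha, j, hj, b, hb, rfl, rfl, hia, hjb, .inl ⟨hij, he⟩⟩,
      ⟨j, hj, b, hb, i, hi, a, ha, rfl, rfl, hjb, hia, .inr ⟨hij, he⟩⟩⟩
  · obtain ⟨b, hb, hjb, he⟩ := (h i hi a ha hia j hj).2 hij
    exact ⟨b, hb, hjb, ⟨i, hi, a, ha, j, hj, b, hb, rfl, rfl, hia, hjb, .inr ⟨hij, he⟩⟩,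
      ⟨j, hj, b, hb, i, hi, a, ha, rfl, rfl, hjb, hia, .inl ⟨hij, he⟩⟩⟩

theorem exists_not_linkedSem (hVX : ∀ i < n, M.mem i VX) (h₁ : OneConsistentSem n l EX VA EA)
    (hfrag : ¬ FragmentedSem n VX EX)
    (hlink : ¬ ∀ i < n, ∀ a < l, M.mem (pr i a) VA → ∀ b < l, M.mem (pr i b) VA →
      LinkedSem n l VX EX VA EA a b i i) (i : M.Num) (hi : i < n) :
    ∃ a < l, M.mem (pr i a) VA ∧ ∃ b < l, M.mem (pr i b) VA ∧
      ¬ LinkedSem n l VX EX VA EA a b i i := by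
  push Not at hlink
  obtain ⟨j, hj, c, hc, hjc, d, hd, hjd, hcd⟩ := hlink
  obtain ⟨C, hdC, hC, hpath⟩ := exists_component (StepRel n l EX VA EA) (mul_add_lt hj hd)
  -- Otherwise the short path from `c` to the root `d` would link them.
  have hcC : ¬ M.mem (j * l + c) C := fun h => by
    obtain ⟨s, hs, P, f, hP, h0, hsf, -, hf⟩ := hpath _ h
    exact hcd (linkedSem_of_path hVX hP hs hc hj hd hjd h0 hsf hf)
  obtain ⟨a, ha, hia, haC⟩ := forall_of_not_fragmented hVX hfrag
    (fun i => ∃ a < l, M.mem (pr i a) VA ∧ M.mem (i * l + a) C) ⟨j, hj, d, hd, hjd, hdC⟩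
    (fun i hi j hj hij ⟨a, ha, hia, haC⟩ => by
      obtain ⟨b, hb, hjb, -, hstep⟩ := h₁.exists_step hi ha hia hj hij
      exact ⟨b, hb, hjb, hC _ _ haC (mul_add_lt hj hb) hstep⟩) inferInstance i hi
  obtain ⟨b, hb, hib, hbC⟩ := forall_of_not_fragmented hVX hfrag
    (fun i => ∃ a < l, M.mem (pr i a) VA ∧ ¬ M.mem (i * l + a) C) ⟨j, hj, c, hc, hjc, hcC⟩
    (fun i hi j hj hij ⟨a, ha, hia, haC⟩ => by
      obtain ⟨b, hb, hjb, hstep, -⟩ := h₁.exists_step hi ha hia hj hij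
      exact ⟨b, hb, hjb, fun h => haC (hC _ _ h (mul_add_lt hi ha) hstep)⟩) inferInstance i hi
  exact ⟨a, ha, hia, b, hb, hib, fun h => hbC (h.mem_of_mem hC hi ha hia hi hb hib haC)⟩

end Linkedness

end BA

open BA in
theorem mainTheorem5 :
    Proves V1 (sentence <|
      BA.allN fun n => BA.allN fun l =>
      BA.allS fun VX => BA.allS fun EX => BA.allS fun VA => BA.allS fun EA =>
        let Θ : Inst := ⟨n, l, VX, EX, VA, EA⟩
        Θ.DG ⩓ Θ.cycleConsistent ⩓ ∼(Θ.isFragmented) ⩓ ∼(Θ.isLinked) ⟹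
          BA.allLt n fun i => Θ.exDom i fun a => Θ.exDom i fun b => ∼(Θ.linked a b i i)) := by
  intro M hM v V
  have : V1Model M := ⟨hM⟩
  simp only [sat_sentence, bsat_allN, bsat_allS, bsat_impl, bsat_conj, bsat_neg,
    Inst.cycleConsistent, zero_add, Nat.reduceAdd]
  rintro n l VX EX VA EA ⟨⟨⟨-, hVX⟩, -⟩, ⟨h₁, -⟩, hfrag, hlink⟩
  simp only [Inst.exDom, Inst.allDom, Inst.dom, Inst.edge, Inst.oneConsistent,
    Inst.isFragmented, Inst.isLinked, properSubset,
    exists_eq_left, bsat_exLt, bsat_allLt, bsat_exSLe, bsat_withPair, bsat_rel,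
    bsat_conj, bsat_impl, bsat_equi, bsat_neg, bsat_mem, eval_len,
    eval_var, Function.update_self, Function.update_apply, Nat.reduceEqDiff, reduceIte, Nat.reduceAdd,
    OfNat.zero_ne_ofNat, OfNat.one_ne_ofNat, bsat_linked] at hVX h₁ hfrag hlink ⊢
  exact exists_not_linkedSem hVX h₁ hfrag hlink
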